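/- Let $\mathcal{O}$ be a Noetherian integrally closed domain with field of fractions $F$, let $K$ be a finite Galois extension of $F$, and let $A$ be an $\mathcal{O}$-algebra that is free of finite rank as an $\mathcal{O}$-module. A *symmetrizing form* on $A$ is an $\mathcal{O}$-linear map $t:A\to\mathcal{O}$ with $t(ab)=t(ba)$ for all $a,b\in A$ such that $a\mapsto(x\mapsto t(ax))$ is an isomorphism $A\to\mathrm{Hom}_{\mathcal{O}}(A,\mathcal{O})$. Let $t$ be a symmetrizing form on $A$, let $\bar A\subseteq A$ be a subalgebra and $G$ a finite cyclic group, and assume that $(A,t)$ is the twisted symmetric algebra of $G$ over $\bar A$. This means the following: - $\bar A$ is free of finite rank over $\mathcal{O}$, $\bar t:=t|_{\bar A}$ is a symmetrizing form on $\bar A$, and $A$ is free of finite rank as a left $\bar A$-module; - there is given a family $(A_g)_{g\in G}$ of $\mathcal{O}$-submodules of $A$ with $A=\bigoplus_{g\in G}A_g$, $A_gA_h=A_{gh}$ for all $g,h\in G$, $A_1=\bar A$, $t(A_g)=0$ for $g\neq 1$, and such that every $A_g$ contains a unit of $A$. Write $KA:=K\otimes_{\mathcal{O}}A$ and $K\bar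 A:=K\otimes_{\mathcal{O}}\bar A\subseteq KA$, and assume that the $K$-algebras $KA$, $K\bar A$ and $KG$ are split semisimple. Let $\mathrm{Irr}(\cdot)$ denote the set of ($K$-valued) characters of simple modules. For $\chi\in\mathrm{Irr}(KA)$ let $e(\chi)$ be the central primitive idempotent of $KA$ that acts as the identity on the simple module with character $\chi$ and as $0$ on the other simple modules. Let $s_\chi\in K$ be the Schur element of $\chi$ with respect to $t$, that is, the scalar by which the central element $\chi^\vee\in KA$ defined by $t^K(\chi^\vee a)=\chi(a)$ for all $a\in KA$ acts on the simple module with character $\chi$, where $t^K$ is the $K$-linear extension of $t$. Define $\bar e(\bar\chi)$ and $s_{\bar\chi}$ likewise for $\bar\chi\in\mathrm{Irr}(K\bar A)$, using $\bar t$. The group $G$ acts on the centre of $K\bar A$: for $z$ in the centre, $g(z)$ is the unique element of $K\bar A$ with $g(z)a=az$ for all $a\in A_g$. It acts on $\mathrm{Irr}(K\bar A)$ by $\bar e(g(\bar\chi))=g(\bar e(\bar\chi))$. The group $G^\vee:=\mathrm{Hom}(G,K^\times)$ acts on $\mathrm{Irr}(KA)$ by $(\chi\cdot\xi)(a)=\chi(a)\xi(g)$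 for $\xi\in G^\vee$, $g\in G$ and $a\in A_g$. Then there is a bijection $\bar\Omega\leftrightarrow\Omega$ between the set $\mathrm{Irr}(K\bar A)/G$ of $G$-orbits and the set $\mathrm{Irr}(KA)/G^\vee$ of $G^\vee$-orbits such that, whenever $\bar\Omega$ and $\Omega$ correspond to each other, $$\sum_{\bar\chi\in\bar\Omega}\bar e(\bar\chi)=\sum_{\chi\in\Omega}e(\chi),\qquad |\bar\Omega|\,|\Omega|=|G|,$$ $$\mathrm{Res}^{KA}_{K\bar A}(\chi)=\sum_{\bar\chi\in\bar\Omega}\bar\chi\ \text{ for all }\chi\in\Omega,\qquad \mathrm{Ind}^{KA}_{K\bar A}(\bar\chi)=\sum_{\chi\in\Omega}\chi\ \text{ for all }\bar\chi\in\bar\Omega,$$ where $\mathrm{Ind}^{KA}_{K\bar A}(\bar\chi)$ is the character of $KA\otimes_{K\bar A}\bar X$ for a simple $K\bar A$-module $\bar X$ with character $\bar\chi$. Moreover, for all $\chi\in\Omega$ and $\bar\chi\in\bar\Omega$, $$s_\chi=|\Omega|\,s_{\bar\chi}.$$ -/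

import Mathlib

open scoped TensorProduct

noncomputable section

namespace Clifford

universe u v

/-! ### Characters, central morphisms and blocks of a finite-dimensional algebra over a field -/

section Algebra

variable (K : Type v) [Field K] (B : Type u) [Ring B] [Algebra K B]

/-- The character of a `B`-module `V`: `b ↦ tr (v ↦ b • v)`. -/
def character (V : Type*) [AddCommGroup V] [Module K V] [Module B V] [IsScalarTower K B V] :
    Module.Dual K B :=
  (LinearMap.trace K V) ∘ₗ (Algebra.lsmul K K V : B →ₐ[K] Module.End K V).toLinearMap

/-- The set of irreducible characters of `B`, i.e. of characters of simple `B`-modules.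
(Every simple module is a quotient of `B`, so the universe of `B` contains them all.) -/
def Irr : Set (Module.Dual K B) :=
  {χ | ∃ (V : Type u) (_ : AddCommGroup V) (_ : Module K V) (_ : Module B V)
    (_ : IsScalarTower K B V), IsSimpleModule B V ∧ character K B V = χ}

/-- `B` is split semisimple: semisimple, and the only endomorphisms of a simple `B`-module
are the scalars of `K`. -/
def IsSplitSemisimple : Prop :=
  IsSemisimpleRing B ∧
    ∀ (V : Type u) [AddCommGroup V] [Module K V] [Module B V] [IsScalarTower K B V]
      [IsSimpleModule B V] (f : V →ₗ[B] V), ∃ c : K, ∀ v : V, f v = c • v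

variable {K B}

/-- `e` is the element of `B ≃ ∏ M_χ'` whose `χ`-component is `1` and whose other components
are `0`. -/
def IsBlockOf (χ : Module.Dual K B) (e : B) : Prop :=
  ∀ (V : Type u) [AddCommGroup V] [Module K V] [Module B V] [IsScalarTower K B V]
    [IsSimpleModule B V],
    (character K B V = χ → ∀ v : V, e • v = v) ∧ (character K B V ≠ χ → ∀ v : V, e • v = 0)

/-- The block-idempotent `e(χ)` of a semisimple algebra. -/
def block (χ : Module.Dual K B) : B :=
  Classical.epsilon (IsBlockOf χ)

/-- `c` is the scalar by which the (central) element `z` acts on the simple module of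
character `χ`. -/
def IsCentralValue (χ : Module.Dual K B) (z : B) (c : K) : Prop :=
  ∀ (V : Type u) [AddCommGroup V] [Module K V] [Module B V] [IsScalarTower K B V]
    [IsSimpleModule B V], character K B V = χ → ∀ v : V, z • v = c • v

/-- The central morphism `ω_χ`. -/
def centralValue (χ : Module.Dual K B) (z : B) : K :=
  Classical.epsilon (IsCentralValue χ z)

end Algebra

/-! ### Symmetric algebras and Schur elements -/

section Symmetric

variable {R : Type*} [CommRing R] {A : Type*} [Ring A] [Algebra R A]

/-- The map `a ↦ (x ↦ t (a x))`. -/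
def hat (t : A →ₗ[R] R) : A →ₗ[R] Module.Dual R A :=
  (LinearMap.mul R A).compr₂ t

/-- `t` is a trace function inducing an isomorphism between `A` and its dual. -/
structure IsSymmetrizingForm (t : A →ₗ[R] R) : Prop where
  trace : ∀ a b : A, t (a * b) = t (b * a)
  bijective : Function.Bijective (hat t)

/-- `S` is a symmetric subalgebra of `(A, t)`. Here `A` is an `S`-module by left
multiplication. -/
structure IsSymmetricSubalgebra (t : A →ₗ[R] R) (S : Subalgebra R A) : Prop where
  free_base : Module.Free R S
  finite_base : Module.Finite R S
  symmetrizing : IsSymmetrizingForm (t ∘ₗ S.val.toLinearMap)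
  free : Module.Free S A
  finite : Module.Finite S A

/-- The element `τ^∨` with `t (τ^∨ a) = τ a` for all `a`. -/
def dualElement (t : A →ₗ[R] R) (τ : Module.Dual R A) : A :=
  Function.invFun (hat t) τ

/-- The extension of scalars `t^K` of the form `t`. -/
def formExt (K : Type*) [Field K] [Algebra R K] (t : A →ₗ[R] R) :
    (K ⊗[R] A) →ₗ[K] K :=
  (TensorProduct.AlgebraTensorModule.rid R K K).toLinearMap ∘ₗ t.baseChange K

/-- The Schur element `s_χ = ω_χ (χ^∨)` of `χ ∈ Irr (KA)` with respect to `t`. -/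
def schurElement {K : Type*} [Field K] [Algebra R K] (t : A →ₗ[R] R)
    (χ : Module.Dual K (K ⊗[R] A)) : K :=
  centralValue χ (dualElement (formExt K t) χ)

end Symmetric

/-! ### Induced modules -/

section Induction

variable {K : Type*} [Field K] {C B : Type*} [Ring C] [Algebra K C] [Ring B] [Algebra K B]

/-- The relations `b ι(c) ⊗ v = b ⊗ c v` that define `B ⊗_C V` as a quotient of `B ⊗_K V`. -/
def indRelations (ι : C →ₐ[K] B) (V : Type*) [AddCommGroup V] [Module K V] [Module C V] :
    Submodule B (B ⊗[K] V) :=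
  Submodule.span B {z | ∃ (b : B) (c : C) (v : V), z = (b * ι c) ⊗ₜ[K] v - b ⊗ₜ[K] (c • v)}

/-- The induced `B`-module `B ⊗_C V`, where `B` is a right `C`-module through `ι`. -/
abbrev Ind (ι : C →ₐ[K] B) (V : Type*) [AddCommGroup V] [Module K V] [Module C V] : Type _ :=
  (B ⊗[K] V) ⧸ indRelations ι V

end Induction

/-! ### Twisted symmetric algebras of a finite group -/

section Twisted

variable {R : Type*} [CommRing R] {A : Type*} [Ring A] [Algebra R A] {G : Type*} [Group G]

/-- `(A, t)` is the twisted symmetric algebra of `G` over the subalgebra `S`, with the family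
`(A_g)` of submodules. -/
structure IsTwistedSymmetricAlgebra [DecidableEq G] (t : A →ₗ[R] R) (S : Subalgebra R A)
    (𝒜 : G → Submodule R A) : Prop where
  symmetrizing : IsSymmetrizingForm t
  subalgebra : IsSymmetricSubalgebra t S
  directSum : DirectSum.IsInternal 𝒜
  mul : ∀ g h : G, 𝒜 g * 𝒜 h = 𝒜 (g * h)
  one : 𝒜 1 = Subalgebra.toSubmodule S
  form_eq_zero : ∀ g : G, g ≠ 1 → ∀ a ∈ 𝒜 g, t a = 0
  exists_unit : ∀ g : G, ∃ a ∈ 𝒜 g, IsUnit a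

variable (K : Type*) [Field K] [Algebra R K]

/-- The inclusion of `KS` in `KA`. -/
def incl (S : Subalgebra R A) : (K ⊗[R] S) →ₐ[K] (K ⊗[R] A) :=
  Algebra.TensorProduct.map (AlgHom.id K K) S.val

variable {K}

/-- `z' = g(z)`, where `g(z)` is the element of `KS` with `g(z) a = a z` for all `a ∈ K A_g`
(it is enough to let `a` run through `A_g`). -/
def IsTranslate (S : Subalgebra R A) (𝒜 : G → Submodule R A) (g : G) (z z' : K ⊗[R] S) : Prop :=
  ∀ a ∈ 𝒜 g, incl K S z' * ((1 : K) ⊗ₜ[R] a) = ((1 : K) ⊗ₜ[R] a) * incl K S z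

/-- The orbit of `χ` under the action of `G` on `Irr (KS)`, where `g(χ)` is the irreducible
character whose block is `g(e(χ))`. -/
def orbit (S : Subalgebra R A) (𝒜 : G → Submodule R A) (χ : Module.Dual K (K ⊗[R] S)) :
    Set (Module.Dual K (K ⊗[R] S)) :=
  {ψ | ψ ∈ Irr K (K ⊗[R] S) ∧ ∃ g : G, IsTranslate S 𝒜 g (block χ) (block ψ)}

/-- `ψ = χ · ξ`, i.e. `ψ(a) = χ(a) ξ(g)` for all `g` and all `a ∈ A_g`; as the `A_g` span `KA`
over `K`, this determines `ψ`. -/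
def IsTwist (𝒜 : G → Submodule R A) (ξ : G →* Kˣ) (χ ψ : Module.Dual K (K ⊗[R] A)) : Prop :=
  ∀ g : G, ∀ a ∈ 𝒜 g, ψ ((1 : K) ⊗ₜ[R] a) = χ ((1 : K) ⊗ₜ[R] a) * (ξ g : K)

/-- The orbit of `χ` under the action `χ ↦ χ · ξ` of `G^∨ = Hom(G, K^×)` on `Irr (KA)`. -/
def dualOrbit (𝒜 : G → Submodule R A) (χ : Module.Dual K (K ⊗[R] A)) :
    Set (Module.Dual K (K ⊗[R] A)) :=
  {ψ | ψ ∈ Irr K (K ⊗[R] A) ∧ ∃ ξ : G →* Kˣ, IsTwist 𝒜 ξ χ ψ}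

variable (K)

/-- The set `Irr (KS) / G` of orbits. -/
def Orbits (S : Subalgebra R A) (𝒜 : G → Submodule R A) :
    Set (Set (Module.Dual K (K ⊗[R] S))) :=
  orbit S 𝒜 '' Irr K (K ⊗[R] S)

/-- The set `Irr (KA) / G^∨` of orbits. -/
def DualOrbits (𝒜 : G → Submodule R A) : Set (Set (Module.Dual K (K ⊗[R] A))) :=
  dualOrbit 𝒜 '' Irr K (K ⊗[R] A)

end Twisted

end Clifford

end

universe w₁ w₂

open scoped TensorProduct

noncomputable section

/-! Write `B = KA` and `C = KĀ`. Since `KG` is split semisimple and `G` is cyclic, `K` contains all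
`|G|`-th roots of unity and `|G|` is invertible in `K`
(`hasEnoughRootsOfUnity_of_isSplitSemisimple`). Thus `G^∨` is cyclic of order `|G|`. It acts on the
graded algebra `B` by automorphisms that scale the component of degree `g` by `ξ(g)`. Only the
grading, the inclusion of `C` in degree `1` and the homogeneous units are needed; `IsCrossedProduct`
records them.

The engine is `exists_sum_isTwistedHom`. For simple `B`-modules `V`, `W`, conjugation by homogeneous
units makes `G` act on `Hom_C(V, W)`, and a Fourier transform over `G` splits each `C`-linear map
into eigenvectors. An eigenvector for `ξ` is a `B`-homomorphism from the twist of `V` by `ξ` to `W`,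
so by Schur's lemma it is zero or bijective, and unique up to a scalar. This has two consequences.

Simple modules with a common constituent over `C` are twists of each other
(`exists_character_eq_of_mem_constituents`). The constituents of one simple module form a `G`-orbit
(`constituents_pull_eq_orbit`), and twisting does not change them. Hence the bijection of orbits.

`End_C(V)` has a basis indexed by the stabilizer of `χ` in `G^∨`. As this stabilizer is cyclic,
`End_C(V)` is generated by one element, hence commutative (`end_comm`, `finrank_end`). So the
restriction of `V` is multiplicity-free with `|Stab χ|` constituents, and `|Ω̄| |Ω| = |Stab χ| [G^∨
: Stab χ] = |G|`.

Averaging over `G^∨` gives `∑_{χ' ∈ Ω} χ' = |Ω| χ ∘ P 1`, where `P 1` is the projection to degree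
`1` (`finsum_orbit_apply`). The trace of an induced module has the same value, which is the
induction formula. As `t` lives in degree `1`, dualizing gives `∑_Ω χ^∨ = |Ω| ∑_Ω̄ ψ^∨`, whose
action on a constituent compares the Schur elements. -/

namespace Clifford

universe u v

/-! ### Irreducible characters and blocks of split semisimple algebras -/

section SplitSemisimple

variable {K : Type v} [Field K] {B : Type u} [Ring B] [Algebra K B]

section Character

variable {V W : Type*} [AddCommGroup V] [Module K V] [Module B V] [IsScalarTower K B V]
  [AddCommGroup W] [Module K W] [Module B W] [IsScalarTower K B W]

theorem character_apply (b : B) :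
    character K B V b = LinearMap.trace K V (Algebra.lsmul K K V b) := rfl

theorem character_congr (e : V ≃ₗ[B] W) : character K B V = character K B W := by
  ext b
  rw [character_apply, character_apply, ← LinearMap.trace_conj' _ (e.restrictScalars K)]
  congr 1
  ext w
  simp [LinearEquiv.conj_apply]

theorem character_mul_comm (a b : B) : character K B V (a * b) = character K B V (b * a) := by
  rw [character_apply, character_apply, map_mul (Algebra.lsmul K K V),
    map_mul (Algebra.lsmul K K V), LinearMap.trace_mul_comm]

theorem finite_of_isSimpleModule [Module.Finite K B] [IsSimpleModule B V] : Module.Finite K V :=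
  Module.Finite.trans B V

end Character

theorem eq_zero_of_forall_simple [IsSemisimpleRing B] {b : B}
    (h : ∀ (V : Type u) [AddCommGroup V] [Module K V] [Module B V] [IsScalarTower K B V]
      [IsSimpleModule B V], ∀ v : V, b • v = 0) : b = 0 := by
  have h1 : ∀ x : B, b * x = 0 := by
    intro x
    have hx : x ∈ sSup {m : Submodule B B | IsSimpleModule B m} := by
      rw [IsSemisimpleModule.sSup_simples_eq_top]; trivial
    rw [sSup_eq_iSup'] at hx
    induction hx using Submodule.iSup_induction' with
    | mem i x hx =>
      have : IsSimpleModule B i.1 := i.2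
      have := h i.1 ⟨x, hx⟩
      simpa using congrArg Subtype.val this
    | zero => simp
    | add x y _ _ hx hy => rw [mul_add, hx, hy, add_zero]
  simpa using h1 1

/-- The element `e` is the component of `1` in the `V`-isotypic part of `B`. The complement `J`
contains no copy of `V`, hence has no nonzero map to `V`, so the other component of `1` kills `V`.
The isotypic part maps to zero in every simple module not isomorphic to `V`. -/
theorem exists_idempotent_of_isSimpleModule [IsSemisimpleRing B] (V : Type u) [AddCommGroup V]
    [Module B V] [IsSimpleModule B V] :
    ∃ e : B, (∀ v : V, e • v = v) ∧ ∀ (W : Type u) [AddCommGroup W] [Module B W]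
      [IsSimpleModule B W], ¬ Nonempty (V ≃ₗ[B] W) → ∀ w : W, e • w = 0 := by
  obtain ⟨J, hJ⟩ := exists_isCompl (isotypicComponent B B V)
  have h1 : (1 : B) ∈ isotypicComponent B B V ⊔ J := by rw [hJ.sup_eq_top]; trivial
  obtain ⟨e, he, f, hf, hef⟩ := Submodule.mem_sup.1 h1
  refine ⟨e, fun v => ?_, fun W _ _ _ hW w => ?_⟩
  · have hfv : f • v = 0 := by
      by_contra hne
      let φ : J →ₗ[B] V := (LinearMap.toSpanSingleton B V v).comp J.subtype
      have hφ : φ ≠ 0 := fun h => hne (by simpa [φ] using LinearMap.congr_fun h ⟨f, hf⟩)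
      obtain ⟨S, ⟨eq⟩⟩ := LinearMap.linearEquiv_of_ne_zero hφ
      have hS : S.map J.subtype ≤ isotypicComponent B B V := by
        refine le_sSup ⟨?_⟩
        exact (Submodule.equivMapOfInjective J.subtype J.injective_subtype S).symm.trans eq.symm
      have hS' : S.map J.subtype ≤ J := Submodule.map_subtype_le J S
      have hbot : S.map J.subtype = ⊥ := by
        rw [eq_bot_iff, ← hJ.inf_eq_bot]; exact le_inf hS hS'
      have := IsSimpleModule.nontrivial B V
      obtain ⟨v', hv'⟩ := exists_ne (0 : V)
      have : (eq v' : J).1 ∈ S.map J.subtype := ⟨_, (eq v').2, rfl⟩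
      rw [hbot, Submodule.mem_bot] at this
      exact hv' (by simpa using this)
    calc e • v = e • v + f • v := by rw [hfv, add_zero]
      _ = v := by rw [← add_smul, hef, one_smul]
  · have hle : isotypicComponent B B V ≤ LinearMap.ker (LinearMap.toSpanSingleton B W w) := by
      refine sSup_le fun m hm => ?_
      obtain ⟨eq⟩ := hm
      have : IsSimpleModule B m := IsSimpleModule.congr eq
      intro x hx
      rcases LinearMap.bijective_or_eq_zero
        ((LinearMap.toSpanSingleton B W w).comp m.subtype) with hb | h0
      · exact absurd ⟨eq.symm.trans (LinearEquiv.ofBijective _ hb)⟩ hW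
      · simpa using LinearMap.congr_fun h0 ⟨x, hx⟩
    simpa using hle he

theorem eq_of_forall_simple (h : IsSplitSemisimple K B) {a b : B}
    (hab : ∀ (V : Type u) [AddCommGroup V] [Module K V] [Module B V] [IsScalarTower K B V]
      [IsSimpleModule B V], ∀ v : V, a • v = b • v) : a = b := by
  have := h.1
  refine sub_eq_zero.1 (eq_zero_of_forall_simple (K := K) fun V _ _ _ _ _ v => ?_)
  rw [sub_smul, hab, sub_self]

theorem irr_mul_comm {χ : Module.Dual K B} (hχ : χ ∈ Irr K B) (a b : B) : χ (a * b) = χ (b * a) := by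
  obtain ⟨V, _, _, _, _, _, rfl⟩ := hχ
  exact character_mul_comm a b

theorem exists_smul_eq_of_central (h : IsSplitSemisimple K B) {z : B} (hz : ∀ b, z * b = b * z)
    (V : Type u) [AddCommGroup V] [Module K V] [Module B V] [IsScalarTower K B V]
    [IsSimpleModule B V] : ∃ c : K, ∀ v : V, z • v = c • v :=
  h.2 V { toFun := fun v => z • v
          map_add' := smul_add z
          map_smul' := fun b v => by simp [← mul_smul, hz] }

theorem apply_dualElement_mul {T : B →ₗ[K] K} (hT : IsSymmetrizingForm T) (τ : Module.Dual K B)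
    (b : B) : T (dualElement T τ * b) = τ b :=
  LinearMap.congr_fun (Function.rightInverse_invFun hT.bijective.2 τ) b

theorem IsSymmetrizingForm.ext {T : B →ₗ[K] K} (hT : IsSymmetrizingForm T) {x y : B}
    (hxy : ∀ b, T (x * b) = T (y * b)) : x = y :=
  hT.bijective.1 (LinearMap.ext hxy)

theorem dualElement_mul_comm {T : B →ₗ[K] K} (hT : IsSymmetrizingForm T) {τ : Module.Dual K B}
    (hτ : ∀ a b, τ (a * b) = τ (b * a)) (b : B) :
    dualElement T τ * b = b * dualElement T τ := by
  refine hT.ext fun x => ?_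
  rw [mul_assoc, apply_dualElement_mul hT, hT.trace, ← mul_assoc, hT.trace,
    apply_dualElement_mul hT, hτ]

/-- An element of a semisimple algebra is determined by its action on simple modules, so the choice
made in `block` is forced. -/
theorem IsBlockOf.eq_block (h : IsSplitSemisimple K B) {χ : Module.Dual K B} {e : B}
    (he : IsBlockOf χ e) : e = block χ := by
  have hb : IsBlockOf χ (block χ) := Classical.epsilon_spec (p := IsBlockOf χ) ⟨e, he⟩
  refine eq_of_forall_simple h fun V _ _ _ _ _ v => ?_
  by_cases hV : character K B V = χ
  · rw [(he V).1 hV, (hb V).1 hV]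
  · rw [(he V).2 hV, (hb V).2 hV]

variable [Module.Finite K B]

/-- The value at `1` is a dimension, which may vanish in positive characteristic. Instead, the
density theorem yields `b` acting as the rank-one map `v ↦ φ v • x`, whose trace `φ x` is nonzero.
-/
theorem exists_character_ne_zero (h : IsSplitSemisimple K B) (V : Type u) [AddCommGroup V]
    [Module K V] [Module B V] [IsScalarTower K B V] [IsSimpleModule B V] :
    ∃ b : B, character K B V b ≠ 0 := by
  have := finite_of_isSimpleModule (K := K) (B := B) (V := V)
  have := IsSimpleModule.nontrivial B V
  have hs := h.2 V
  obtain ⟨x, hx⟩ := exists_ne (0 : V)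
  obtain ⟨φ, hφ⟩ := Module.Projective.exists_dual_ne_zero K hx
  -- Linearity over `End_B(V)` holds because, by splitness, these endomorphisms are scalars.
  let f : Module.End (Module.End B V) V :=
    { toFun := fun v => φ v • x
      map_add' := fun v w => by rw [map_add, add_smul]
      map_smul' := fun g v => by
        obtain ⟨c, hc⟩ := hs g
        simp [hc, mul_smul] }
  classical
  obtain ⟨b, hb⟩ := jacobson_density (R := B) f (Finset.univ.image (Module.finBasis K V))
  refine ⟨b, ?_⟩
  have hbf : Algebra.lsmul K K V b = φ.smulRight x := by
    refine (Module.finBasis K V).ext fun i => ?_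
    have := hb (Module.finBasis K V i) (Finset.mem_image_of_mem _ (Finset.mem_univ i))
    simpa [f] using this.symm
  rwa [character_apply, hbf, LinearMap.trace_smulRight]

/-- Otherwise some `e` acts as `1` on `V` and as `0` on `W`, so the common character takes the same
value at `b` and `e * b`, and that value is `0`, for every `b`. -/
theorem nonempty_linearEquiv_of_character_eq (h : IsSplitSemisimple K B) (V W : Type u)
    [AddCommGroup V] [Module K V] [Module B V] [IsScalarTower K B V] [IsSimpleModule B V]
    [AddCommGroup W] [Module K W] [Module B W] [IsScalarTower K B W] [IsSimpleModule B W]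
    (hVW : character K B V = character K B W) : Nonempty (V ≃ₗ[B] W) := by
  by_contra hne
  have := h.1
  obtain ⟨e, he, he'⟩ := exists_idempotent_of_isSimpleModule (B := B) V
  obtain ⟨b, hb⟩ := exists_character_ne_zero h V
  apply hb
  have h1 : character K B V b = character K B V (e * b) := by
    rw [character_apply, character_apply]
    congr 1
    ext v
    simp [he]
  rw [h1, hVW, character_apply]
  have : Algebra.lsmul K K W (e * b) = 0 := by
    ext w
    simp [he' W hne]
  rw [this, map_zero]

theorem isBlockOf_block (h : IsSplitSemisimple K B) {χ : Module.Dual K B} (hχ : χ ∈ Irr K B) :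
    IsBlockOf χ (block χ) := by
  refine Classical.epsilon_spec (p := IsBlockOf χ) ?_
  obtain ⟨V, _, _, _, _, _, rfl⟩ := hχ
  have := h.1
  obtain ⟨e, he, he'⟩ := exists_idempotent_of_isSimpleModule (B := B) V
  refine ⟨e, fun W _ _ _ _ _ => ⟨fun hW w => ?_, fun hW => he' W fun ⟨f⟩ => ?_⟩⟩
  · obtain ⟨f⟩ := nonempty_linearEquiv_of_character_eq h W V hW
    apply f.injective
    rw [map_smul, he]
  · exact hW (character_congr f).symm

variable {χ χ' : Module.Dual K B}

theorem block_mul_comm (h : IsSplitSemisimple K B) (hχ : χ ∈ Irr K B) (b : B) :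
    block χ * b = b * block χ := by
  have hb := isBlockOf_block h hχ
  refine eq_of_forall_simple h fun V _ _ _ _ _ v => ?_
  by_cases hV : character K B V = χ
  · rw [mul_smul, mul_smul, (hb V).1 hV, (hb V).1 hV]
  · rw [mul_smul, mul_smul, (hb V).2 hV, (hb V).2 hV, smul_zero]

theorem block_mul_self (h : IsSplitSemisimple K B) (hχ : χ ∈ Irr K B) :
    block χ * block χ = block χ := by
  have hb := isBlockOf_block h hχ
  refine eq_of_forall_simple h fun V _ _ _ _ _ v => ?_
  by_cases hV : character K B V = χ
  · rw [mul_smul, (hb V).1 hV, (hb V).1 hV]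
  · rw [mul_smul, (hb V).2 hV, (hb V).2 hV]

theorem block_mul_of_ne (h : IsSplitSemisimple K B) (hχ : χ ∈ Irr K B) (hχ' : χ' ∈ Irr K B)
    (hne : χ ≠ χ') : block χ * block χ' = 0 := by
  refine eq_of_forall_simple h fun V _ _ _ _ _ v => ?_
  rw [mul_smul, zero_smul]
  by_cases hV : character K B V = χ
  · rw [((isBlockOf_block h hχ') V).2 (by rwa [hV]), smul_zero]
  · rw [((isBlockOf_block h hχ) V).2 hV]

theorem irr_apply_block_mul (h : IsSplitSemisimple K B) (hχ : χ ∈ Irr K B) (b : B) :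
    χ (block χ * b) = χ b := by
  have hb := isBlockOf_block h hχ
  obtain ⟨V, _, _, _, _, _, rfl⟩ := hχ
  rw [character_apply, character_apply]
  congr 1
  ext v
  simp [(hb V).1 rfl]

theorem irr_apply_block_mul_of_ne (h : IsSplitSemisimple K B) (hχ : χ ∈ Irr K B)
    (hχ' : χ' ∈ Irr K B) (hne : χ ≠ χ') (b : B) : χ (block χ' * b) = 0 := by
  rw [← irr_apply_block_mul h hχ, ← mul_assoc, block_mul_of_ne h hχ hχ' hne, zero_mul, map_zero]

theorem irr_ne_zero (h : IsSplitSemisimple K B) (hχ : χ ∈ Irr K B) : χ ≠ 0 := by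
  obtain ⟨V, _, _, _, _, _, rfl⟩ := hχ
  obtain ⟨b, hb⟩ := exists_character_ne_zero h V
  exact fun h0 => hb (by rw [h0, LinearMap.zero_apply])

theorem block_ne_zero (h : IsSplitSemisimple K B) (hχ : χ ∈ Irr K B) : block χ ≠ 0 := by
  intro h0
  refine irr_ne_zero h hχ (LinearMap.ext fun b => ?_)
  rw [← irr_apply_block_mul h hχ, h0, zero_mul, map_zero, LinearMap.zero_apply]

theorem block_injOn (h : IsSplitSemisimple K B) : Set.InjOn block (Irr K B) := by
  intro χ hχ χ' hχ' heq
  by_contra hne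
  apply block_ne_zero h hχ
  rw [← block_mul_self h hχ]
  nth_rewrite 2 [heq]
  exact block_mul_of_ne h hχ hχ' hne

/-- Evaluating a linear relation at `block χ * b` isolates the coefficient of `χ`. Finiteness of
`Irr K B` follows from this. -/
theorem irr_linearIndepOn (h : IsSplitSemisimple K B) : LinearIndepOn K id (Irr K B) := by
  rw [linearIndepOn_iff']
  intro s g hs hsum χ hχ
  obtain ⟨b, hb⟩ : ∃ b, χ b ≠ 0 := by
    by_contra! h0
    exact irr_ne_zero h (hs hχ) (LinearMap.ext h0)
  have h1 := LinearMap.congr_fun hsum (block χ * b)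
  rw [LinearMap.sum_apply, Finset.sum_eq_single χ] at h1
  · simpa [irr_apply_block_mul h (hs hχ), hb] using h1
  · intro χ' hχ' hne
    simp [irr_apply_block_mul_of_ne h (hs hχ') (hs hχ) hne]
  · exact fun hn => absurd hχ hn

theorem irr_finite (h : IsSplitSemisimple K B) : (Irr K B).Finite :=
  LinearIndependent.setFinite (irr_linearIndepOn h)

theorem sum_block (h : IsSplitSemisimple K B) :
    ∑ χ ∈ (irr_finite h).toFinset, block χ = 1 := by
  refine eq_of_forall_simple h fun V _ _ _ _ _ v => ?_
  have hV : character K B V ∈ Irr K B := ⟨V, _, _, _, _, ‹_›, rfl⟩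
  rw [Finset.sum_smul, Finset.sum_eq_single (character K B V), one_smul,
    (isBlockOf_block h hV V).1 rfl]
  · intro χ hχ hne
    exact (isBlockOf_block h (by simpa using hχ) V).2 hne.symm v
  · exact fun hn => absurd (by simpa using hV) hn

theorem sum_block_smul_of_mem (h : IsSplitSemisimple K B) {s : Finset (Module.Dual K B)}
    (hs : (s : Set (Module.Dual K B)) ⊆ Irr K B) (V : Type u) [AddCommGroup V] [Module K V]
    [Module B V] [IsScalarTower K B V] [IsSimpleModule B V] (hV : character K B V ∈ s) (v : V) :
    (∑ χ ∈ s, block χ) • v = v := by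
  rw [Finset.sum_smul, Finset.sum_eq_single_of_mem _ hV, (isBlockOf_block h (hs hV) V).1 rfl]
  exact fun χ hχ hne => (isBlockOf_block h (hs hχ) V).2 hne.symm v

theorem sum_block_smul_of_notMem (h : IsSplitSemisimple K B) {s : Finset (Module.Dual K B)}
    (hs : (s : Set (Module.Dual K B)) ⊆ Irr K B) (V : Type u) [AddCommGroup V] [Module K V]
    [Module B V] [IsScalarTower K B V] [IsSimpleModule B V] (hV : character K B V ∉ s) (v : V) :
    (∑ χ ∈ s, block χ) • v = 0 := by
  rw [Finset.sum_smul]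
  exact Finset.sum_eq_zero fun χ hχ =>
    (isBlockOf_block h (hs hχ) V).2 (fun h' => hV (h' ▸ hχ)) v

/-! ### Central elements and Schur elements -/

/-- The scalar depends only on the character because simple modules with equal characters are
isomorphic; this makes the choice in `centralValue` meaningful. -/
theorem centralValue_smul (h : IsSplitSemisimple K B) {z : B} (hz : ∀ b, z * b = b * z)
    (V : Type u) [AddCommGroup V] [Module K V] [Module B V] [IsScalarTower K B V]
    [IsSimpleModule B V] (v : V) : z • v = centralValue (character K B V) z • v := by
  obtain ⟨c, hc⟩ := exists_smul_eq_of_central h hz V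
  refine Classical.epsilon_spec (p := IsCentralValue (character K B V) z) ⟨c, ?_⟩ V rfl v
  intro W _ _ _ _ _ hW w
  obtain ⟨f⟩ := nonempty_linearEquiv_of_character_eq h W V hW
  apply f.injective
  rw [map_smul, hc]
  exact ((f.restrictScalars K).map_smul c w).symm

theorem dualElement_smul_of_ne (h : IsSplitSemisimple K B) {T : B →ₗ[K] K}
    (hT : IsSymmetrizingForm T) (hχ : χ ∈ Irr K B) (V : Type u) [AddCommGroup V] [Module K V]
    [Module B V] [IsScalarTower K B V] [IsSimpleModule B V] (hV : character K B V ≠ χ) (v : V) :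
    dualElement T χ • v = 0 := by
  have : dualElement T χ = dualElement T χ * block χ := by
    refine hT.ext fun x => ?_
    rw [mul_assoc, apply_dualElement_mul hT, apply_dualElement_mul hT, irr_apply_block_mul h hχ]
  rw [this, mul_smul, (isBlockOf_block h hχ V).2 hV, smul_zero]

end SplitSemisimple

/-! ### Restriction of modules along algebra homomorphisms -/

section Pull

variable {K : Type v} [Field K] {C B : Type u} [Ring C] [Algebra K C] [Ring B] [Algebra K B]

/-- The `C`-module obtained from a `B`-module `V` by restriction along `φ : C → B`. -/
def Pull (_φ : C →ₐ[K] B) (V : Type*) : Type _ := V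

variable (φ : C →ₐ[K] B) (V : Type*) [AddCommGroup V] [Module K V] [Module B V]

instance : AddCommGroup (Pull φ V) := inferInstanceAs (AddCommGroup V)

instance : Module K (Pull φ V) := inferInstanceAs (Module K V)

instance : Module C (Pull φ V) := Module.compHom V φ.toRingHom

/-- The identity map from `V` to its restriction. -/
def toPull : V ≃ₗ[K] Pull φ V := LinearEquiv.refl K V

variable {φ V}

theorem toPull_symm_smul (c : C) (v : Pull φ V) :
    (toPull φ V).symm (c • v) = φ c • (toPull φ V).symm v := rfl

instance [IsScalarTower K B V] : IsScalarTower K C (Pull φ V) :=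
  ⟨fun k c v => by
    apply (toPull φ V).symm.injective
    rw [toPull_symm_smul, map_smul, map_smul, toPull_symm_smul, smul_assoc]⟩

theorem character_pull [IsScalarTower K B V] :
    character K C (Pull φ V) = character K B V ∘ₗ φ.toLinearMap := by
  ext c
  rw [LinearMap.comp_apply, character_apply, character_apply,
    ← LinearMap.trace_conj' _ (toPull φ V)]
  congr 1

theorem isSimpleModule_pull [IsSimpleModule B V] (hφ : Function.Surjective φ) :
    IsSimpleModule C (Pull φ V) := by
  have : RingHomSurjective φ.toRingHom := ⟨hφ⟩
  let l : Pull φ V →ₛₗ[φ.toRingHom] V :=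
    { toFun := (toPull φ V).symm
      map_add' := fun _ _ => rfl
      map_smul' := fun _ _ => rfl }
  exact (LinearMap.isSimpleModule_iff_of_bijective l (toPull φ V).symm.bijective).2 inferInstance

theorem comp_mem_irr {χ : Module.Dual K B} (hχ : χ ∈ Irr K B) (hφ : Function.Surjective φ) :
    χ ∘ₗ φ.toLinearMap ∈ Irr K C := by
  obtain ⟨V, _, _, _, _, _, rfl⟩ := hχ
  exact ⟨Pull φ V, inferInstance, inferInstance, inferInstance, inferInstance,
    isSimpleModule_pull hφ, character_pull⟩

/-- Restricting a simple `B`-module along `σ` shows that the left side has the defining property of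
`block χ`. -/
theorem apply_block_comp [Module.Finite K B] [Module.Finite K C] (hB : IsSplitSemisimple K B)
    (hC : IsSplitSemisimple K C) {χ : Module.Dual K B} (hχ : χ ∈ Irr K B) (σ : C ≃ₐ[K] B) :
    σ (block (χ ∘ₗ σ.toLinearMap)) = block χ := by
  have hb := isBlockOf_block hC (comp_mem_irr (φ := (σ : C →ₐ[K] B)) hχ σ.surjective)
  refine IsBlockOf.eq_block hB fun V _ _ _ _ _ => ?_
  have := isSimpleModule_pull (φ := (σ : C →ₐ[K] B)) (V := V) σ.surjective
  have hV := character_pull (φ := (σ : C →ₐ[K] B)) (V := V)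
  have hσ : ∀ χ₁ χ₂ : Module.Dual K B, χ₁ ∘ₗ (σ : C →ₐ[K] B).toLinearMap =
      χ₂ ∘ₗ (σ : C →ₐ[K] B).toLinearMap → χ₁ = χ₂ := fun χ₁ χ₂ h => by
    ext b
    simpa using LinearMap.congr_fun h (σ.symm b)
  refine ⟨fun h v => ?_, fun h v => ?_⟩
  · rw [h] at hV
    exact (hb (Pull (σ : C →ₐ[K] B) V)).1 hV (toPull _ V v)
  · refine (hb (Pull (σ : C →ₐ[K] B) V)).2 (fun h' => h ?_) (toPull _ V v)
    exact hσ _ _ (hV.symm.trans h')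

end Pull

/-! ### Sums over orbits -/

theorem sum_smul_eq_card_stabilizer_nsmul {H α M : Type*} [Group H] [Fintype H] [MulAction H α]
    [AddCommMonoid M] (f : α → M) (x : α) :
    ∑ h : H, f (h • x) =
      Nat.card (MulAction.stabilizer H x) • ∑ᶠ y ∈ MulAction.orbit H x, f y := by
  classical
  have hfin : (MulAction.orbit H x).Finite := Set.finite_range _
  rw [finsum_mem_eq_finite_toFinset_sum _ hfin, Finset.smul_sum,
    ← Finset.sum_fiberwise_of_maps_to (s := Finset.univ) (t := hfin.toFinset)
      (g := fun h : H => h • x) (fun h _ => by simp)]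
  refine Finset.sum_congr rfl fun y hy => ?_
  obtain ⟨k, rfl⟩ : ∃ k : H, k • x = y := MulAction.mem_orbit_iff.1 (by simpa using hy)
  rw [Finset.sum_congr rfl (g := fun _ => f (k • x)) fun h hh => by
    rw [(Finset.mem_filter.1 hh).2], Finset.sum_const]
  congr 1
  rw [Nat.card_eq_fintype_card, ← Finset.card_univ]
  -- The fibre of `h ↦ h • x` over `k • x` is the coset of the stabilizer through `k`.
  refine Finset.card_bij' (fun h hh => ⟨k⁻¹ * h, ?_⟩) (fun s _ => k * s.1) ?_ ?_ ?_ ?_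
  · rw [MulAction.mem_stabilizer_iff, mul_smul, (Finset.mem_filter.1 hh).2, inv_smul_smul]
  · simp
  · intro s _
    rw [Finset.mem_filter]
    exact ⟨Finset.mem_univ _, by rw [mul_smul, MulAction.mem_stabilizer_iff.1 s.2]⟩
  · simp
  · simp

/-! ### Linear characters of finite cyclic groups -/

section LinearCharacters

variable (G K : Type*) [Group G] [Finite G] [Field K] [HasEnoughRootsOfUnity K (Nat.card G)]

theorem natCast_card_ne_zero : (Nat.card G : K) ≠ 0 := by
  obtain ⟨ζ, hζ⟩ := HasEnoughRootsOfUnity.exists_primitiveRoot K (Nat.card G)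
  have : NeZero (Nat.card G) := ⟨Nat.card_pos.ne'⟩
  exact hζ.neZero'.out

variable [IsCyclic G]

theorem nonempty_linearCharacters_mulEquiv : Nonempty ((G →* Kˣ) ≃* G) := by
  let _ : CommGroup G := IsCyclic.commGroup
  have : HasEnoughRootsOfUnity K (Monoid.exponent G) := by rwa [IsCyclic.exponent_eq_card]
  exact CommGroup.monoidHom_mulEquiv_of_hasEnoughRootsOfUnity G K

theorem isCyclic_linearCharacters : IsCyclic (G →* Kˣ) := by
  obtain ⟨e⟩ := nonempty_linearCharacters_mulEquiv G K
  exact isCyclic_of_surjective e.symm e.symm.surjective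

theorem finite_linearCharacters : Finite (G →* Kˣ) := by
  obtain ⟨e⟩ := nonempty_linearCharacters_mulEquiv G K
  exact Finite.of_equiv G e.symm

theorem card_linearCharacters : Nat.card (G →* Kˣ) = Nat.card G := by
  obtain ⟨e⟩ := nonempty_linearCharacters_mulEquiv G K
  exact Nat.card_congr e.toEquiv

variable {G K}

theorem sum_linearCharacters_apply [Fintype (G →* Kˣ)] {g : G} (hg : g ≠ 1) :
    ∑ ξ : G →* Kˣ, (ξ g : K) = 0 := by
  let _ : CommGroup G := IsCyclic.commGroup
  have : HasEnoughRootsOfUnity K (Monoid.exponent G) := by rwa [IsCyclic.exponent_eq_card]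
  obtain ⟨η, hη⟩ := CommGroup.exists_apply_ne_one_of_hasEnoughRootsOfUnity G K hg
  have h1 : (η g : K) * ∑ ξ : G →* Kˣ, (ξ g : K) = ∑ ξ : G →* Kˣ, (ξ g : K) := by
    rw [Finset.mul_sum]
    exact Fintype.sum_equiv (Equiv.mulLeft η) _ _ fun ξ => by simp
  have h2 : ((η g : K) - 1) * ∑ ξ : G →* Kˣ, (ξ g : K) = 0 := by
    rw [sub_mul, h1, one_mul, sub_self]
  exact (mul_eq_zero.1 h2).resolve_left fun h => hη (Units.ext (by simpa [sub_eq_zero] using h))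

end LinearCharacters

/-! ### Multiplicity-free modules -/

section MultiplicityFree

variable {K : Type v} [Field K] {C : Type u} [Ring C] [Algebra K C]
  {M : Type u} [AddCommGroup M] [Module C M]

variable (K C M) in
/-- The irreducible characters that occur in the module `M`. -/
def constituents : Set (Module.Dual K C) :=
  {ψ | ψ ∈ Irr K C ∧ ∃ m : M, block ψ • m ≠ 0}

theorem block_smul_eq_zero {ψ : Module.Dual K C} (hψ : ψ ∈ Irr K C) (h : ψ ∉ constituents K C M)
    (m : M) : block ψ • m = 0 := by
  by_contra hne
  exact h ⟨hψ, m, hne⟩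

variable [Module.Finite K C] (hC : IsSplitSemisimple K C)
include hC

theorem sum_block_smul (m : M) : m = ∑ ψ ∈ (irr_finite hC).toFinset, block ψ • m := by
  rw [← Finset.sum_smul, sum_block hC, one_smul]

variable [Module K M] [IsScalarTower K C M]

theorem exists_simple_submodule_of_mem_constituents {ψ : Module.Dual K C}
    (hψ : ψ ∈ constituents K C M) :
    ∃ X : Submodule C M, IsSimpleModule C X ∧ character K C X = ψ := by
  obtain ⟨hψ, m, hm⟩ := hψ
  have := hC.1
  let N : Submodule C M := Submodule.span C {block ψ • m}
  have hN : N ≠ ⊥ := by simpa [N] using hm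
  obtain ⟨X, hXN, hX⟩ := (IsSemisimpleModule.eq_bot_or_exists_simple_le N).resolve_left hN
  refine ⟨X, hX, ?_⟩
  by_contra hne
  have := IsSimpleModule.nontrivial C X
  obtain ⟨x, hx⟩ := exists_ne (0 : X)
  apply hx
  have h0 := (isBlockOf_block hC hψ X).2 hne x
  obtain ⟨c, hc⟩ := Submodule.mem_span_singleton.1 (hXN x.2)
  rw [← h0]
  apply Subtype.ext
  rw [Submodule.coe_smul, ← hc, ← mul_smul, ← mul_smul, block_mul_comm hC hψ, mul_assoc,
    block_mul_self hC hψ]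

/-- A commutative endomorphism ring excludes a second copy of `X`. If `X'` were one in a complement
`Y`, the map `f : M → X ≃ X' ⊆ M` would not commute with the projection `p` onto `X`: on `X`, `f ∘
p` is injective while `p ∘ f` vanishes. -/
theorem block_smul_mem_of_commute (hcomm : ∀ f g : Module.End C M, f * g = g * f)
    {ψ : Module.Dual K C} (hψ : ψ ∈ Irr K C) (X : Submodule C M) [IsSimpleModule C X]
    (hX : character K C X = ψ) (m : M) : block ψ • m ∈ X := by
  have := hC.1
  obtain ⟨Y, hXY⟩ := exists_isCompl X
  by_contra hm
  obtain ⟨x, hx, y, hy, hxy⟩ := Submodule.mem_sup.1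
    (show block ψ • m ∈ X ⊔ Y by rw [hXY.sup_eq_top]; trivial)
  have hy0 : y ≠ 0 := by
    rintro rfl
    exact hm (by rwa [← hxy, add_zero])
  have hby : block ψ • y = y := by
    have hbx : block ψ • x = x :=
      congrArg Subtype.val ((isBlockOf_block hC hψ X).1 hX ⟨x, hx⟩)
    have h2 : block ψ • (x + y) = x + y := by
      rw [hxy, ← mul_smul, block_mul_self hC hψ]
    rw [smul_add, hbx] at h2
    exact add_left_cancel h2
  obtain ⟨X', hX', hψ'⟩ := exists_simple_submodule_of_mem_constituents hC (M := Y)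
    (ψ := ψ) ⟨hψ, ⟨y, hy⟩, fun h0 => hy0 (by rw [← hby]; exact congrArg Subtype.val h0)⟩
  obtain ⟨φ⟩ := nonempty_linearEquiv_of_character_eq hC X X' (hX.trans hψ'.symm)
  let p : M →ₗ[C] X := X.projectionOnto Y hXY
  let f : Module.End C M := Y.subtype ∘ₗ X'.subtype ∘ₗ φ.toLinearMap ∘ₗ p
  have hpX : ∀ x : X, p x = x := fun x => Submodule.projectionOnto_apply_left hXY x
  have hpY : ∀ y : Y, p y = 0 := fun y => Submodule.projectionOnto_apply_right hXY y
  have := IsSimpleModule.nontrivial C X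
  obtain ⟨x, hx⟩ := exists_ne (0 : X)
  have h1 := LinearMap.congr_fun (hcomm f (X.subtype ∘ₗ p)) x
  simp only [Module.End.mul_apply, LinearMap.comp_apply, Submodule.subtype_apply, f, hpX, hpY,
    LinearEquiv.coe_coe] at h1
  apply hx
  apply φ.injective
  apply Subtype.ext
  apply Subtype.ext
  rw [h1]
  simp

theorem character_eq_sum_constituents [Module.Finite K M]
    (hcomm : ∀ f g : Module.End C M, f * g = g * f) :
    character K C M = ∑ᶠ ψ ∈ constituents K C M, ψ := by
  classical
  have hsub : constituents K C M ⊆ Irr K C := fun ψ h => h.1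
  have hfin := (irr_finite hC).subset hsub
  rw [finsum_mem_eq_finite_toFinset_sum _ hfin]
  ext c
  have hc : c = ∑ ψ ∈ (irr_finite hC).toFinset, c * block ψ := by
    rw [← Finset.mul_sum, sum_block hC, mul_one]
  conv_lhs => rw [hc, map_sum]
  rw [LinearMap.sum_apply]
  symm
  refine Finset.sum_subset_zero_on_sdiff (by simpa using hsub) (fun ψ hψ => ?_) fun ψ hψ => ?_
  · simp only [Finset.mem_sdiff, Set.Finite.mem_toFinset] at hψ
    rw [character_apply]
    have h0 : Algebra.lsmul K K M (c * block ψ) = 0 := by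
      ext m
      simp [block_smul_eq_zero hψ.1 hψ.2]
    rw [h0, map_zero]
  · have hψ' : ψ ∈ constituents K C M := by simpa using hψ
    obtain ⟨X, hX, hXψ⟩ := exists_simple_submodule_of_mem_constituents hC hψ'
    have hmem := block_smul_mem_of_commute hC hcomm hψ'.1 X hXψ
    have hb := (isBlockOf_block hC hψ'.1 X).1 hXψ
    let p : M →ₗ[K] X := ((Algebra.lsmul K K M (block ψ)).codRestrict (X.restrictScalars K) hmem)
    let i : X →ₗ[K] M := (X.restrictScalars K).subtype
    -- The action of `c * block ψ` factors through `X`, so cyclicity of the trace moves the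
    -- computation from `M` to `X`.
    have h1 : Algebra.lsmul K K M (c * block ψ) = (Algebra.lsmul K K M c ∘ₗ i) ∘ₗ p := by
      ext m
      exact mul_smul c (block ψ) m
    have := finite_of_isSimpleModule (K := K) (B := C) (V := X)
    rw [character_apply, h1, LinearMap.trace_comp_comm', ← hXψ, character_apply]
    congr 1
    ext x
    exact congrArg Subtype.val (hb (c • x)).symm

/-- The actions of the blocks of the constituents form a basis of `End_C(M)`: they are nonzero
orthogonal idempotents with sum `1`, and each has image in a simple submodule, on which splitness
reduces any endomorphism to a scalar. -/
theorem finrank_end_eq_ncard_constituents [Module.Finite K M]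
    (hcomm : ∀ f g : Module.End C M, f * g = g * f) :
    Module.finrank K (Module.End C M) = (constituents K C M).ncard := by
  classical
  have hsub : constituents K C M ⊆ Irr K C := fun ψ h => h.1
  have hfin := (irr_finite hC).subset hsub
  have := hfin.fintype
  let b : constituents K C M → Module.End C M := fun ψ =>
    { toFun := fun m => block ψ.1 • m
      map_add' := smul_add _
      map_smul' := fun c m => by simp [← mul_smul, block_mul_comm hC ψ.2.1] }
  have hli : LinearIndependent K b := by
    rw [Fintype.linearIndependent_iff]
    intro a ha ψ
    obtain ⟨m, hm⟩ := ψ.2.2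
    have h1 := LinearMap.congr_fun ha (block ψ.1 • m)
    rw [LinearMap.sum_apply, Finset.sum_eq_single ψ] at h1
    · have h2 : a ψ • block ψ.1 • block ψ.1 • m = 0 := h1
      rw [← mul_smul (block ψ.1), block_mul_self hC ψ.2.1] at h2
      exact (smul_eq_zero.1 h2).resolve_right hm
    · intro ψ' _ hne
      change a ψ' • block ψ'.1 • block ψ.1 • m = 0
      rw [← mul_smul (block ψ'.1), block_mul_of_ne hC ψ'.2.1 ψ.2.1 fun h => hne (Subtype.ext h),
        zero_smul, smul_zero]
    · simp
  have hsp : ⊤ ≤ Submodule.span K (Set.range b) := by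
    intro f _
    have hsc : ∀ ψ : constituents K C M, ∃ c : K, f * b ψ = c • b ψ := by
      intro ψ
      obtain ⟨X, hX, hXψ⟩ := exists_simple_submodule_of_mem_constituents hC ψ.2
      have hmem := block_smul_mem_of_commute hC hcomm ψ.2.1 X hXψ
      have hb := (isBlockOf_block hC ψ.2.1 X).1 hXψ
      obtain ⟨c, hc⟩ := hC.2 X (((b ψ * f).codRestrict X fun m => hmem (f m)) ∘ₗ X.subtype)
      refine ⟨c, LinearMap.ext fun m => ?_⟩
      have h1 := congrArg Subtype.val (hc ⟨block ψ.1 • m, hmem m⟩)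
      simp only [LinearMap.comp_apply] at h1
      have h2 : (b ψ * f) (block ψ.1 • m) = c • (block ψ.1 • m) := h1
      rw [hcomm] at h2
      simpa [b, ← mul_smul, block_mul_self hC ψ.2.1] using h2
    choose c hc using hsc
    have hf : f = ∑ ψ, c ψ • b ψ := by
      have h1 : (1 : Module.End C M) = ∑ ψ, b ψ := by
        ext m
        rw [LinearMap.sum_apply]
        conv_lhs => rw [Module.End.one_apply, sum_block_smul hC m]
        rw [← Finset.sum_subset (Set.Finite.toFinset_subset_toFinset.2 hsub : hfin.toFinset ⊆ _)
          fun ψ hψ hψ' => block_smul_eq_zero (by simpa using hψ) (by simpa using hψ') m]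
        exact Finset.sum_subtype _ (by simp) _
      calc f = f * 1 := (mul_one f).symm
        _ = _ := by rw [h1, Finset.mul_sum]; exact Finset.sum_congr rfl fun ψ _ => hc ψ
    rw [hf]
    exact Submodule.sum_mem _ fun ψ _ => Submodule.smul_mem _ _ (Submodule.subset_span ⟨ψ, rfl⟩)
  rw [Module.finrank_eq_card_basis (Module.Basis.mk hli hsp), ← Nat.card_eq_fintype_card,
    Nat.card_coe_set_eq]

end MultiplicityFree

/-! ### Crossed products -/

section CrossedProduct

variable {K : Type v} [Field K] {C B : Type u} [Ring C] [Algebra K C] [Ring B] [Algebra K B]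
  {G : Type*} [Group G] [Fintype G]

/-- `B` is graded by `G` with components `𝓑 g` and projections `P g`, the component of degree `1`
is the image of `C`, and `y g` is a homogeneous unit of degree `g`. -/
structure IsCrossedProduct (ι : C →ₐ[K] B) (𝓑 : G → Submodule K B) (P : G → B →ₗ[K] B)
    (y : G → Bˣ) : Prop where
  injective : Function.Injective ι
  mem_one : ∀ x, x ∈ 𝓑 1 ↔ ∃ c, ι c = x
  mul_mem : ∀ {g h : G} {a b : B}, a ∈ 𝓑 g → b ∈ 𝓑 h → a * b ∈ 𝓑 (g * h)
  proj_mem : ∀ g x, P g x ∈ 𝓑 g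
  proj_of_mem : ∀ {g : G} {x : B}, x ∈ 𝓑 g → P g x = x
  proj_of_ne : ∀ {g h : G} {x : B}, x ∈ 𝓑 h → g ≠ h → P g x = 0
  sum_proj : ∀ x, ∑ g, P g x = x
  unit_mem : ∀ g, (y g : B) ∈ 𝓑 g
  inv_mem : ∀ g, (((y g)⁻¹ : Bˣ) : B) ∈ 𝓑 g⁻¹

/-- `w` is a homogeneous unit of degree `g`. -/
def IsHomogeneousUnit (𝓑 : G → Submodule K B) (g : G) (w : Bˣ) : Prop :=
  (w : B) ∈ 𝓑 g ∧ ((w⁻¹ : Bˣ) : B) ∈ 𝓑 g⁻¹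

variable {ι : C →ₐ[K] B} {𝓑 : G → Submodule K B} {P : G → B →ₗ[K] B} {y : G → Bˣ}

namespace IsCrossedProduct

theorem isHomogeneousUnit (hd : IsCrossedProduct ι 𝓑 P y) (g : G) :
    IsHomogeneousUnit 𝓑 g (y g) :=
  ⟨hd.unit_mem g, hd.inv_mem g⟩

theorem homogeneous_mul (hd : IsCrossedProduct ι 𝓑 P y) {g h : G} {w z : Bˣ}
    (hw : IsHomogeneousUnit 𝓑 g w) (hz : IsHomogeneousUnit 𝓑 h z) :
    IsHomogeneousUnit 𝓑 (g * h) (w * z) := by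
  refine ⟨hd.mul_mem hw.1 hz.1, ?_⟩
  rw [mul_inv_rev, mul_inv_rev]
  exact hd.mul_mem hz.2 hw.2

omit [Fintype G] in
theorem homogeneous_inv {g : G} {w : Bˣ}
    (hw : IsHomogeneousUnit 𝓑 g w) : IsHomogeneousUnit 𝓑 g⁻¹ w⁻¹ :=
  ⟨hw.2, by simpa using hw.1⟩

theorem ι_mem (hd : IsCrossedProduct ι 𝓑 P y) (c : C) : ι c ∈ 𝓑 1 := (hd.mem_one _).2 ⟨c, rfl⟩

theorem homogeneous_one (hd : IsCrossedProduct ι 𝓑 P y) : IsHomogeneousUnit 𝓑 1 (1 : Bˣ) :=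
  ⟨by simpa using hd.ι_mem 1, by simpa using hd.ι_mem 1⟩

theorem induction_on (hd : IsCrossedProduct ι 𝓑 P y) {p : B → Prop}
    (hmem : ∀ g, ∀ x ∈ 𝓑 g, p x) (hadd : ∀ a b, p a → p b → p (a + b)) (x : B) : p x := by
  rw [← hd.sum_proj x]
  exact Finset.sum_induction _ p hadd (hmem 1 0 (zero_mem _)) fun g _ => hmem g _ (hd.proj_mem g x)

theorem proj_mul_of_mem_left (hd : IsCrossedProduct ι 𝓑 P y) {g : G} {a : B} (ha : a ∈ 𝓑 g)
    (h : G) (b : B) : P (g * h) (a * b) = a * P h b := by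
  induction b using hd.induction_on with
  | hmem k b hb =>
    by_cases hk : h = k
    · subst hk
      rw [hd.proj_of_mem hb, hd.proj_of_mem (hd.mul_mem ha hb)]
    · rw [hd.proj_of_ne hb hk, mul_zero, hd.proj_of_ne (hd.mul_mem ha hb) (by simpa using hk)]
  | hadd b b' h h' => rw [mul_add, map_add, map_add, mul_add, h, h']

theorem proj_mul_of_mem_right (hd : IsCrossedProduct ι 𝓑 P y) {h : G} {b : B} (hb : b ∈ 𝓑 h)
    (g : G) (a : B) : P (g * h) (a * b) = P g a * b := by
  induction a using hd.induction_on with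
  | hmem k a ha =>
    by_cases hk : g = k
    · subst hk
      rw [hd.proj_of_mem ha, hd.proj_of_mem (hd.mul_mem ha hb)]
    · rw [hd.proj_of_ne ha hk, zero_mul, hd.proj_of_ne (hd.mul_mem ha hb) (by simpa using hk)]
  | hadd a a' h h' => rw [add_mul, map_add, map_add, add_mul, h, h']

theorem proj_ι_mul (hd : IsCrossedProduct ι 𝓑 P y) (c : C) (b : B) :
    P 1 (ι c * b) = ι c * P 1 b := by
  simpa using hd.proj_mul_of_mem_left (hd.ι_mem c) 1 b

theorem proj_mul_ι (hd : IsCrossedProduct ι 𝓑 P y) (c : C) (b : B) :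
    P 1 (b * ι c) = P 1 b * ι c := by
  simpa using hd.proj_mul_of_mem_right (hd.ι_mem c) 1 b

/-! #### The action of the linear characters -/

theorem sum_smul_proj_of_mem (hd : IsCrossedProduct ι 𝓑 P y) (ξ : G →* Kˣ) {g : G} {x : B}
    (hx : x ∈ 𝓑 g) : (∑ h, (ξ h : K) • P h) x = (ξ g : K) • x := by
  rw [LinearMap.sum_apply, Finset.sum_eq_single g]
  · rw [LinearMap.smul_apply, hd.proj_of_mem hx]
  · intro h _ hne
    rw [LinearMap.smul_apply, hd.proj_of_ne hx hne, smul_zero]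
  · simp

/-- The automorphism of `B` that multiplies the component of degree `g` by `ξ g`. -/
def twist (hd : IsCrossedProduct ι 𝓑 P y) (ξ : G →* Kˣ) : B →ₐ[K] B :=
  AlgHom.ofLinearMap (∑ h, (ξ h : K) • P h)
    (by rw [hd.sum_smul_proj_of_mem ξ (g := 1) (by simpa using hd.ι_mem 1)]; simp)
    (fun a b => by
      induction a using hd.induction_on with
      | hmem g a ha =>
        induction b using hd.induction_on with
        | hmem h b hb =>
          rw [hd.sum_smul_proj_of_mem ξ ha, hd.sum_smul_proj_of_mem ξ hb,
            hd.sum_smul_proj_of_mem ξ (hd.mul_mem ha hb), map_mul, smul_mul_smul_comm,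
            Units.val_mul]
        | hadd b b' h h' => rw [mul_add, map_add, map_add, mul_add, h, h']
      | hadd a a' h h' => rw [add_mul, map_add, map_add, add_mul, h, h'])

theorem twist_of_mem (hd : IsCrossedProduct ι 𝓑 P y) (ξ : G →* Kˣ) {g : G} {x : B}
    (hx : x ∈ 𝓑 g) : hd.twist ξ x = (ξ g : K) • x :=
  hd.sum_smul_proj_of_mem ξ hx

theorem twist_twist (hd : IsCrossedProduct ι 𝓑 P y) (ξ η : G →* Kˣ) (b : B) :
    hd.twist ξ (hd.twist η b) = hd.twist (ξ * η) b := by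
  induction b using hd.induction_on with
  | hmem g b hb =>
    rw [hd.twist_of_mem η hb, map_smul, hd.twist_of_mem ξ hb, hd.twist_of_mem _ hb, smul_smul,
      mul_comm, MonoidHom.mul_apply, Units.val_mul]
  | hadd b b' h h' => rw [map_add, map_add, map_add, h, h']

theorem twist_one (hd : IsCrossedProduct ι 𝓑 P y) (b : B) : hd.twist 1 b = b := by
  induction b using hd.induction_on with
  | hmem g b hb => rw [hd.twist_of_mem _ hb]; simp
  | hadd b b' h h' => rw [map_add, h, h']

theorem twist_surjective (hd : IsCrossedProduct ι 𝓑 P y) (ξ : G →* Kˣ) :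
    Function.Surjective (hd.twist ξ) :=
  fun b => ⟨hd.twist ξ⁻¹ b, (hd.twist_twist ξ ξ⁻¹ b).trans
    ((congrArg (hd.twist · b) (mul_inv_cancel ξ)).trans (hd.twist_one b))⟩

theorem twist_ι (hd : IsCrossedProduct ι 𝓑 P y) (ξ : G →* Kˣ) (c : C) :
    hd.twist ξ (ι c) = ι c := by
  rw [hd.twist_of_mem ξ (hd.ι_mem c), map_one, Units.val_one, one_smul]

/-- Orthogonality of linear characters kills every degree other than `1`. -/
theorem sum_twist [IsCyclic G] [HasEnoughRootsOfUnity K (Nat.card G)] [Fintype (G →* Kˣ)]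
    (hd : IsCrossedProduct ι 𝓑 P y) (b : B) :
    ∑ ξ, hd.twist ξ b = (Nat.card G : K) • P 1 b := by
  induction b using hd.induction_on with
  | hmem g b hb =>
    simp_rw [hd.twist_of_mem _ hb]
    rw [← Finset.sum_smul]
    by_cases hg : g = 1
    · subst hg
      rw [hd.proj_of_mem hb, ← card_linearCharacters G K]
      simp
    · rw [sum_linearCharacters_apply hg, hd.proj_of_ne hb (Ne.symm hg), zero_smul, smul_zero]
  | hadd b b' h h' => simp_rw [map_add]; rw [Finset.sum_add_distrib, h, h', smul_add]

/-- The action of linear characters on linear forms. -/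
@[reducible] def dualAction (hd : IsCrossedProduct ι 𝓑 P y) :
    MulAction (G →* Kˣ) (Module.Dual K B) where
  smul ξ χ := χ ∘ₗ (hd.twist ξ).toLinearMap
  one_smul χ := LinearMap.ext fun b => congrArg χ (hd.twist_one b)
  -- Precomposition reverses products; it is a left action because the linear characters commute.
  mul_smul ξ η χ := LinearMap.ext fun b => congrArg χ
    ((congrArg (hd.twist · b) (mul_comm ξ η)).trans (hd.twist_twist η ξ b).symm)

/-! #### The action of the group on the irreducible characters of `C` -/

theorem exists_conj (hd : IsCrossedProduct ι 𝓑 P y) {g : G} {w : Bˣ}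
    (hw : IsHomogeneousUnit 𝓑 g w) (c : C) : ∃ c' : C, ι c' = w * ι c * (w⁻¹ : Bˣ) := by
  rw [← hd.mem_one]
  simpa using hd.mul_mem (hd.mul_mem hw.1 (hd.ι_mem c)) hw.2

/-- Conjugation by a homogeneous unit. -/
def conjHom (hd : IsCrossedProduct ι 𝓑 P y) {g : G} {w : Bˣ}
    (hw : IsHomogeneousUnit 𝓑 g w) : C →ₐ[K] C :=
  have h (c : C) := (hd.exists_conj hw c).choose_spec
  AlgHom.ofLinearMap
    { toFun := fun c => (hd.exists_conj hw c).choose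
      map_add' := fun a b => hd.injective (by rw [h, map_add, map_add, h, h]; noncomm_ring)
      map_smul' := fun k a => hd.injective (by
        rw [h, map_smul, RingHom.id_apply, map_smul, h, mul_smul_comm, smul_mul_assoc]) }
    (hd.injective ((h 1).trans (by simp)))
    (fun a b => hd.injective (by
      simp only [LinearMap.coe_mk, AddHom.coe_mk]
      rw [h, map_mul, map_mul, h, h]
      simp [mul_assoc]))

theorem ι_conjHom (hd : IsCrossedProduct ι 𝓑 P y) {g : G} {w : Bˣ}
    (hw : IsHomogeneousUnit 𝓑 g w) (c : C) :
    ι (hd.conjHom hw c) = w * ι c * (w⁻¹ : Bˣ) :=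
  (hd.exists_conj hw c).choose_spec

/-- Conjugation by `(y g)⁻¹`. -/
def conj (hd : IsCrossedProduct ι 𝓑 P y) (g : G) : C ≃ₐ[K] C :=
  AlgEquiv.ofAlgHom (hd.conjHom (homogeneous_inv (hd.isHomogeneousUnit g)))
    (hd.conjHom (hd.isHomogeneousUnit g))
    (AlgHom.ext fun c => hd.injective (by simp [ι_conjHom, mul_assoc]))
    (AlgHom.ext fun c => hd.injective (by simp [ι_conjHom, mul_assoc]))

theorem ι_conj (hd : IsCrossedProduct ι 𝓑 P y) (g : G) (c : C) :
    ι (hd.conj g c) = ((y g)⁻¹ : Bˣ) * ι c * y g := by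
  have := hd.ι_conjHom (homogeneous_inv (hd.isHomogeneousUnit g)) c
  rwa [inv_inv] at this

/-- Two homogeneous units of the same degree differ by a unit of `C`, and characters do not see
inner automorphisms of `C`. Hence conjugation gives an action of `G` on `Irr K C` although `g ↦ y g`
need not be multiplicative. -/
theorem irr_conj_apply (hd : IsCrossedProduct ι 𝓑 P y) {ψ : Module.Dual K C} (hψ : ψ ∈ Irr K C)
    {g : G} {w : Bˣ} (hw : IsHomogeneousUnit 𝓑 g w) {c c' : C}
    (hc : ι c' = w * ι c * (w⁻¹ : Bˣ)) : ψ (hd.conj g c') = ψ c := by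
  have hz := hd.homogeneous_mul (homogeneous_inv (hd.isHomogeneousUnit g)) hw
  rw [inv_mul_cancel] at hz
  obtain ⟨s, hs⟩ := (hd.mem_one _).1 hz.1
  obtain ⟨s', hs'⟩ := (hd.mem_one _).1 (by simpa using hz.2)
  have h1 : hd.conj g c' = s * c * s' := hd.injective (by
    rw [hd.ι_conj, hc, map_mul, map_mul, hs, hs']
    simp [mul_assoc])
  have h2 : s' * s = 1 := hd.injective (by
    rw [map_mul, hs, hs', map_one]
    simp [mul_assoc])
  rw [h1, irr_mul_comm hψ, ← mul_assoc, h2, one_mul]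

/-- The action of `G` on the irreducible characters of `C`. -/
@[reducible] def irrAction (hd : IsCrossedProduct ι 𝓑 P y) : MulAction G (Irr K C) where
  smul g ψ := ⟨ψ.1 ∘ₗ ((hd.conj g : C →ₐ[K] C)).toLinearMap,
    comp_mem_irr ψ.2 (hd.conj g).surjective⟩
  one_smul ψ := Subtype.ext (LinearMap.ext fun c =>
    hd.irr_conj_apply ψ.2 hd.homogeneous_one (by simp))
  mul_smul g h ψ := Subtype.ext (LinearMap.ext fun c =>
    hd.irr_conj_apply ψ.2 (hd.homogeneous_mul (hd.isHomogeneousUnit g) (hd.isHomogeneousUnit h))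
      (by simp [ι_conj, mul_assoc]))

variable [Module.Finite K C]

theorem ι_block_smul (hd : IsCrossedProduct ι 𝓑 P y) (hC : IsSplitSemisimple K C)
    (g : G) (ψ : Irr K C) :
    letI := hd.irrAction
    ι (block (g • ψ : Irr K C).1) * y g = y g * ι (block ψ.1) := by
  have h := apply_block_comp hC hC ψ.2 (hd.conj g)
  rw [← h, hd.ι_conj]
  simp only [← mul_assoc]
  simp
  rfl

theorem mem_orbit_irr_iff (hd : IsCrossedProduct ι 𝓑 P y) (hC : IsSplitSemisimple K C)
    (ψ ψ' : Irr K C) :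
    letI := hd.irrAction
    ψ' ∈ MulAction.orbit G ψ ↔ ∃ g, ι (block ψ'.1) * y g = y g * ι (block ψ.1) := by
  let _ := hd.irrAction
  rw [MulAction.mem_orbit_iff]
  refine exists_congr fun g => ⟨?_, fun h => ?_⟩
  · rintro rfl
    exact hd.ι_block_smul hC g ψ
  · rw [← hd.ι_block_smul hC] at h
    exact Subtype.ext (block_injOn hC ψ'.2 (g • ψ).2 (hd.injective (by simpa using h))).symm

/-- Every `b` of degree `g` is `y g * ι c`, and `block ψ` commutes with `c`; so the relation may be
tested on the single unit `y g`. -/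
theorem ι_block_mul_of_mem (hd : IsCrossedProduct ι 𝓑 P y) (hC : IsSplitSemisimple K C)
    {ψ ψ' : Module.Dual K C} (hψ : ψ ∈ Irr K C) {g : G}
    (h : ι (block ψ') * y g = y g * ι (block ψ)) {b : B} (hb : b ∈ 𝓑 g) :
    ι (block ψ') * b = b * ι (block ψ) := by
  obtain ⟨c, hc⟩ := (hd.mem_one (((y g)⁻¹ : Bˣ) * b)).1 (by
    simpa using hd.mul_mem (hd.inv_mem g) hb)
  have hb' : b = y g * ι c := by simp [hc]
  rw [hb', ← mul_assoc, h, mul_assoc, mul_assoc, ← map_mul, ← map_mul, block_mul_comm hC hψ]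

end IsCrossedProduct
end CrossedProduct

/-! ### Simple modules over a crossed product -/

section CrossedProductModules

variable {K : Type v} [Field K] {C B : Type u} [Ring C] [Algebra K C] [Ring B] [Algebra K B]
  {G : Type*} [Group G] [Fintype G]
  {ι : C →ₐ[K] B} {𝓑 : G → Submodule K B} {P : G → B →ₗ[K] B} {y : G → Bˣ}
  {V W : Type u} [AddCommGroup V] [Module K V] [Module B V] [IsScalarTower K B V]
  [AddCommGroup W] [Module K W] [Module B W] [IsScalarTower K B W]

/-! #### Homomorphisms twisted by a linear character -/

/-- `f` is a homomorphism of `B`-modules from the twist of `V` by `ξ` to `W`. -/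
def IsTwistedHom (hd : IsCrossedProduct ι 𝓑 P y) (ξ : G →* Kˣ) (f : V →ₗ[K] W) : Prop :=
  ∀ (b : B) (v : V), f (hd.twist ξ b • v) = b • f v

namespace IsTwistedHom

variable {hd : IsCrossedProduct ι 𝓑 P y} {ξ η : G →* Kˣ}

/-- A twisted homomorphism as a homomorphism of `B`-modules. -/
def toHom {f : V →ₗ[K] W} (hf : IsTwistedHom hd ξ f) : Pull (hd.twist ξ) V →ₗ[B] W where
  toFun v := f ((toPull (hd.twist ξ) V).symm v)
  map_add' := f.map_add
  map_smul' b v := hf b v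

omit [IsScalarTower K B V] [IsScalarTower K B W] in
theorem ι_smul {f : V →ₗ[K] W} (hf : IsTwistedHom hd ξ f) (c : C) (v : V) :
    f (ι c • v) = ι c • f v := by
  rw [← hf, hd.twist_ι]

omit [IsScalarTower K B V] [IsScalarTower K B W] in
theorem bijective [IsSimpleModule B V] [IsSimpleModule B W] {f : V →ₗ[K] W}
    (hf : IsTwistedHom hd ξ f) (h0 : f ≠ 0) : Function.Bijective f := by
  have := isSimpleModule_pull (V := V) (hd.twist_surjective ξ)
  have hne : hf.toHom ≠ 0 := fun h => h0 (LinearMap.ext fun v => LinearMap.congr_fun h v)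
  exact (LinearMap.bijective_of_ne_zero hne : Function.Bijective hf.toHom)

theorem character_eq [IsSimpleModule B V] [IsSimpleModule B W] {f : V →ₗ[K] W}
    (hf : IsTwistedHom hd ξ f) (h0 : f ≠ 0) :
    character K B W = character K B V ∘ₗ (hd.twist ξ).toLinearMap := by
  rw [← character_pull, ← character_congr (LinearEquiv.ofBijective hf.toHom (hf.bijective h0))]

omit [IsScalarTower K B V] in
-- The composite `f' ∘ f⁻¹` is a `B`-endomorphism of the simple module `W`, hence a scalar.
theorem exists_eq_smul (hB : IsSplitSemisimple K B) [IsSimpleModule B V] [IsSimpleModule B W]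
    {f f' : V →ₗ[K] W} (hf : IsTwistedHom hd ξ f) (h0 : f ≠ 0) (hf' : IsTwistedHom hd ξ f') :
    ∃ c : K, f' = c • f := by
  let e := LinearEquiv.ofBijective hf.toHom (hf.bijective h0)
  obtain ⟨c, hc⟩ := hB.2 W (hf'.toHom ∘ₗ e.symm.toLinearMap)
  refine ⟨c, LinearMap.ext fun v => ?_⟩
  have h1 := hc (e (toPull _ V v))
  rw [LinearMap.comp_apply, LinearEquiv.coe_coe, LinearEquiv.symm_apply_apply] at h1
  exact h1

omit [IsScalarTower K B V] in
theorem mul {f f' : V →ₗ[K] V} (hf : IsTwistedHom hd ξ f) (hf' : IsTwistedHom hd η f') :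
    IsTwistedHom hd (ξ * η) (f ∘ₗ f') := by
  intro b v
  have h1 : hd.twist (ξ * η) b = hd.twist η (hd.twist ξ b) :=
    (congrArg (hd.twist · b) (mul_comm ξ η)).trans (hd.twist_twist η ξ b).symm
  rw [LinearMap.comp_apply, h1, hf', hf, LinearMap.comp_apply]

omit [IsScalarTower K B V] in
theorem pow {f : Module.End K V} (hf : IsTwistedHom hd ξ f) (k : ℕ) :
    IsTwistedHom hd (ξ ^ k) (f ^ k) := by
  induction k with
  | zero =>
    have h0 : ξ ^ 0 = 1 := pow_zero ξ
    intro b v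
    rw [h0, hd.twist_one, pow_zero, Module.End.one_apply, Module.End.one_apply]
  | succ k ih =>
    have h1 : ξ ^ (k + 1) = ξ ^ k * ξ := pow_succ ξ k
    rw [h1, pow_succ]
    exact ih.mul hf

end IsTwistedHom

theorem exists_isTwistedHom [Module.Finite K B] (hB : IsSplitSemisimple K B)
    [IsSimpleModule B V] [IsSimpleModule B W]
    (hd : IsCrossedProduct ι 𝓑 P y) {ξ : G →* Kˣ}
    (h : character K B W = character K B V ∘ₗ (hd.twist ξ).toLinearMap) :
    ∃ f : V →ₗ[K] W, IsTwistedHom hd ξ f ∧ f ≠ 0 := by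
  have := isSimpleModule_pull (V := V) (hd.twist_surjective ξ)
  rw [← character_pull] at h
  obtain ⟨e⟩ := nonempty_linearEquiv_of_character_eq hB _ _ h.symm
  refine ⟨(e.restrictScalars K).toLinearMap ∘ₗ (toPull (hd.twist ξ) V).toLinearMap,
    fun b v => e.map_smul b (toPull _ V v), fun h0 => ?_⟩
  have := IsSimpleModule.nontrivial B W
  obtain ⟨w, hw⟩ := exists_ne (0 : W)
  have h1 := LinearMap.congr_fun h0 ((toPull _ V).symm (e.symm w))
  exact hw (by simpa using h1)

/-! #### Decomposition of `C`-linear maps -/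

section Decomposition

variable (hd : IsCrossedProduct ι 𝓑 P y) {f : V →ₗ[K] W}
  (hf : ∀ (c : C) (v : V), f (ι c • v) = ι c • f v)
include hd hf

omit [IsScalarTower K B V] [IsScalarTower K B W] in
-- The element `z⁻¹ * w` lies in the image of `C`, and `f` commutes with it.
theorem homogeneous_smul_eq {g : G} {w z : Bˣ} (hw : IsHomogeneousUnit 𝓑 g w)
    (hz : IsHomogeneousUnit 𝓑 g z) (v : V) :
    (w : B) • f (((w⁻¹ : Bˣ) : B) • v) = (z : B) • f (((z⁻¹ : Bˣ) : B) • v) := by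
  have h := hd.homogeneous_mul (IsCrossedProduct.homogeneous_inv hz) hw
  rw [inv_mul_cancel] at h
  obtain ⟨s, hs⟩ := (hd.mem_one _).1 h.1
  have h1 : ((z⁻¹ : Bˣ) : B) • v = ι s • ((w⁻¹ : Bˣ) : B) • v := by
    rw [hs, ← mul_smul]; simp [mul_assoc]
  rw [h1, hf, hs, ← mul_smul]
  simp

variable [IsCyclic G] [HasEnoughRootsOfUnity K (Nat.card G)]

/-- With `D g` the conjugate of `f` by `y g`, the component at `ξ` is the Fourier coefficient `|G|⁻¹
∑ ξ(g)⁻¹ D g`. An element `b` of degree `h` satisfies `D (h * g) (b • v) = b • D g v`, which makes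
this coefficient a twisted homomorphism; Fourier inversion at `g = 1` recovers `f`. -/
theorem exists_sum_isTwistedHom [Fintype (G →* Kˣ)] :
    ∃ F : (G →* Kˣ) → V →ₗ[K] W, (∀ ξ, IsTwistedHom hd ξ (F ξ)) ∧ f = ∑ ξ, F ξ := by
  let D : G → V →ₗ[K] W := fun g =>
    Algebra.lsmul K K W (y g : B) ∘ₗ f ∘ₗ Algebra.lsmul K K V (((y g)⁻¹ : Bˣ) : B)
  have hD : ∀ g v, D g v = (y g : B) • f ((((y g)⁻¹ : Bˣ) : B) • v) := fun g v => rfl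
  have hDι : ∀ g c v, D g (ι c • v) = ι c • D g v := by
    intro g c v
    rw [hD, hD]
    have h1 : (((y g)⁻¹ : Bˣ) : B) • ι c • v = ι (hd.conj g c) • (((y g)⁻¹ : Bˣ) : B) • v := by
      rw [hd.ι_conj, ← mul_smul, ← mul_smul]; simp [mul_assoc]
    rw [h1, hf, hd.ι_conj, ← mul_smul, ← mul_smul]
    simp [← mul_assoc]
  have hDy : ∀ h g v, (y h : B) • D g v = D (h * g) ((y h : B) • v) := by
    intro h g v
    rw [hD, hD, ← homogeneous_smul_eq hd hf
      (hd.homogeneous_mul (hd.isHomogeneousUnit h) (hd.isHomogeneousUnit g))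
      (hd.isHomogeneousUnit (h * g)), ← mul_smul, ← mul_smul]
    simp [mul_assoc]
  -- The unit `y 1` need not be `1`, but conjugating `f` by either gives the same map.
  have hD1 : D 1 = f := by
    ext v
    rw [hD, homogeneous_smul_eq hd hf (hd.isHomogeneousUnit 1) hd.homogeneous_one]
    simp
  have hn := natCast_card_ne_zero G K
  refine ⟨fun ξ => (Nat.card G : K)⁻¹ • ∑ g, (ξ g⁻¹ : K) • D g, fun ξ b v => ?_, ?_⟩
  · induction b using hd.induction_on generalizing v with
    | hmem h b hb =>
      obtain ⟨s, hs⟩ := (hd.mem_one (b * ((y h)⁻¹ : Bˣ))).1 (by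
        simpa using hd.mul_mem hb (hd.inv_mem h))
      have hb' : b = ι s * y h := by simp [hs]
      rw [hd.twist_of_mem ξ hb]
      simp only [LinearMap.smul_apply, LinearMap.sum_apply]
      rw [smul_comm b, Finset.smul_sum (r := b)]
      congr 1
      rw [← Equiv.sum_comp (Equiv.mulLeft h)]
      refine Finset.sum_congr rfl fun g _ => ?_
      have h1 : D (h * g) (b • v) = b • D g v := by
        rw [hb', mul_smul, hDι, ← hDy, mul_smul]
      rw [Equiv.coe_mulLeft, smul_assoc, map_smul, smul_smul, smul_comm b, h1]
      congr 1
      rw [mul_inv_rev, map_mul, ← Units.val_mul, mul_assoc, ← map_mul, inv_mul_cancel, map_one,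
        mul_one]
    | hadd a b ha hb => rw [map_add, add_smul, map_add, ha, hb, add_smul]
  · rw [← Finset.smul_sum, Finset.sum_comm]
    simp_rw [← Finset.sum_smul]
    rw [Finset.sum_eq_single 1]
    · rw [hD1, inv_one]
      simp only [map_one, Units.val_one, Finset.sum_const, Finset.card_univ, nsmul_eq_mul, mul_one]
      rw [← Nat.card_eq_fintype_card, card_linearCharacters, smul_smul, inv_mul_cancel₀ hn,
        one_smul]
    · intro g _ hg
      rw [sum_linearCharacters_apply (inv_ne_one.2 hg), zero_smul]
    · simp

end Decomposition

/-! #### Restriction of simple modules -/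

section Restriction

variable (ι V) in
/-- A `C`-linear endomorphism of the restriction of `V`, as a `K`-linear endomorphism of `V`. -/
def pullEnd : Module.End C (Pull ι V) →ₗ[K] Module.End K V where
  toFun f := (toPull ι V).symm.toLinearMap ∘ₗ f.restrictScalars K ∘ₗ (toPull ι V).toLinearMap
  map_add' _ _ := rfl
  map_smul' _ _ := rfl

theorem pullEnd_injective : Function.Injective (pullEnd ι V) :=
  fun _ _ h => LinearMap.ext fun v => LinearMap.congr_fun h v

theorem pullEnd_ι_smul (f : Module.End C (Pull ι V)) (c : C) (v : V) :
    pullEnd ι V f (ι c • v) = ι c • pullEnd ι V f v :=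
  f.map_smul c (toPull ι V v)

variable [IsCyclic G] [HasEnoughRootsOfUnity K (Nat.card G)] [IsSimpleModule B V]
  [Module.Finite K B] (hd : IsCrossedProduct ι 𝓑 P y) (hB : IsSplitSemisimple K B)
include hd hB

/-- Every `C`-endomorphism is a polynomial in one operator `T`, a twisted automorphism attached to a
generator of the stabilizer of the character. This is where cyclicity of the stabilizer enters. -/
theorem end_comm (f f' : Module.End C (Pull ι V)) : f * f' = f' * f := by
  have := finite_linearCharacters G K
  have := Fintype.ofFinite (G →* Kˣ)
  let _ := hd.dualAction
  have := isCyclic_linearCharacters G K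
  obtain ⟨ξ₀, hξ₀⟩ := IsCyclic.exists_monoid_generator
    (α := MulAction.stabilizer (G →* Kˣ) (character K B V))
  obtain ⟨T, hT, hT0⟩ := exists_isTwistedHom (V := V) (W := V) hB hd (ξ := ξ₀.1) ξ₀.2.symm
  have hpow : ∀ k : ℕ, T ^ k ≠ 0 := fun k => by
    have hbij := hT.bijective hT0
    have := IsSimpleModule.nontrivial B V
    intro h0
    obtain ⟨v, hv⟩ := exists_ne (0 : V)
    have h1 : (T ^ k) v = (T ^ k) 0 := by rw [h0]; rfl
    rw [Module.End.pow_apply, Module.End.pow_apply] at h1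
    exact hv (hbij.1.iterate k h1)
  -- If `S` is nonzero then `ξ` fixes the character, so `ξ = ξ₀ ^ k`; both `S` and `T ^ k` are then
  -- twisted by `ξ`, hence proportional.
  have key : ∀ ξ (S : V →ₗ[K] V), IsTwistedHom hd ξ S → ∃ (c : K) (k : ℕ), S = c • T ^ k := by
    intro ξ S hS
    by_cases h0 : S = 0
    · exact ⟨0, 0, by rw [h0, zero_smul]⟩
    obtain ⟨k, hk⟩ := hξ₀ ⟨ξ, (hS.character_eq h0).symm⟩
    have hk' : ξ₀.1 ^ k = ξ := congrArg Subtype.val hk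
    obtain ⟨c, hc⟩ := (hk' ▸ hT.pow k : IsTwistedHom hd ξ (T ^ k)).exists_eq_smul hB (hpow k) hS
    exact ⟨c, k, hc⟩
  have hadj : ∀ S : Module.End C (Pull ι V), pullEnd ι V S ∈ Algebra.adjoin K {T} := by
    intro S
    obtain ⟨F, hF, hSF⟩ := exists_sum_isTwistedHom hd (pullEnd_ι_smul S)
    rw [hSF]
    refine Subalgebra.sum_mem _ fun ξ _ => ?_
    obtain ⟨c, k, hc⟩ := key ξ (F ξ) (hF ξ)
    rw [hc]
    exact Subalgebra.smul_mem _ (Subalgebra.pow_mem _ (Algebra.self_mem_adjoin_singleton K T) k) c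
  have h1 : Commute (pullEnd ι V f) (pullEnd ι V f') :=
    Algebra.commute_of_mem_adjoin_singleton_of_commute (hadj f')
      (Algebra.commute_of_mem_adjoin_self (hadj f)).symm
  exact pullEnd_injective h1

/-- One twisted automorphism `T ξ` for each `ξ` in the stabilizer gives a basis. These span by the
Fourier decomposition, and they are independent because conjugation by `y g`, for a generator `g` of
`G`, has them as eigenvectors with distinct eigenvalues `ξ g`. -/
theorem finrank_end :
    letI := hd.dualAction
    Module.finrank K (Module.End C (Pull ι V)) =
      Nat.card (MulAction.stabilizer (G →* Kˣ) (character K B V)) := by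
  have := finite_linearCharacters G K
  have := Fintype.ofFinite (G →* Kˣ)
  let _ := hd.dualAction
  have hex : ∀ ξ : MulAction.stabilizer (G →* Kˣ) (character K B V),
      ∃ f : V →ₗ[K] V, IsTwistedHom hd ξ f ∧ f ≠ 0 :=
    fun ξ => exists_isTwistedHom (V := V) (W := V) hB hd (ξ := ξ.1) ξ.2.symm
  choose T hT hT0 using hex
  let b : MulAction.stabilizer (G →* Kˣ) (character K B V) → Module.End C (Pull ι V) := fun ξ =>
    { toFun := fun v => toPull ι V (T ξ ((toPull ι V).symm v))
      map_add' := (T ξ).map_add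
      map_smul' := fun c v => (hT ξ).ι_smul c v }
  have hbT : ∀ ξ, pullEnd ι V (b ξ) = T ξ := fun ξ => rfl
  have hsp : ⊤ ≤ Submodule.span K (Set.range b) := by
    intro f _
    obtain ⟨F, hF, hfF⟩ := exists_sum_isTwistedHom hd (pullEnd_ι_smul f)
    have hmem : pullEnd ι V f ∈ (Submodule.span K (Set.range b)).map (pullEnd ι V) := by
      rw [hfF]
      refine Submodule.sum_mem _ fun ξ _ => ?_
      by_cases h0 : F ξ = 0
      · rw [h0]
        exact zero_mem _
      · let ξ' : MulAction.stabilizer (G →* Kˣ) (character K B V) :=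
          ⟨ξ, ((hF ξ).character_eq h0).symm⟩
        obtain ⟨c, hc⟩ := (hT ξ').exists_eq_smul hB (hT0 ξ') (hF ξ)
        exact ⟨c • b ξ', Submodule.smul_mem _ _ (Submodule.subset_span ⟨ξ', rfl⟩), hc.symm⟩
    obtain ⟨f', hf', hff'⟩ := hmem
    rwa [← pullEnd_injective hff']
  have hli : LinearIndependent K b := by
    obtain ⟨g, hg⟩ := IsCyclic.exists_generator (α := G)
    refine LinearIndependent.of_comp (pullEnd ι V) ?_
    let D : Module.End K (Module.End K V) :=
      { toFun := fun f => Algebra.lsmul K K V (y g : B) * f *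
          Algebra.lsmul K K V (((y g)⁻¹ : Bˣ) : B)
        map_add' := fun f f' => by rw [mul_add, add_mul]
        map_smul' := fun c f => by simp }
    refine Module.End.eigenvectors_linearIndependent' D (fun ξ => (ξ.1 g : K)) ?_ _ fun ξ => ?_
    · intro ξ η h
      refine Subtype.ext (MonoidHom.ext fun x => ?_)
      obtain ⟨k, rfl⟩ := hg x
      simp only [map_zpow]
      rw [Units.ext h]
    · refine ⟨Module.End.mem_eigenspace_iff.2 (LinearMap.ext fun v => ?_), hT0 ξ⟩
      change (y g : B) • T ξ ((((y g)⁻¹ : Bˣ) : B) • v) = (ξ.1 g : K) • T ξ v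
      rw [← hT ξ, hd.twist_of_mem _ (hd.unit_mem g), smul_assoc, map_smul, ← mul_smul]
      simp
  have := Fintype.ofFinite (MulAction.stabilizer (G →* Kˣ) (character K B V))
  rw [Module.finrank_eq_card_basis (Module.Basis.mk hli hsp), ← Nat.card_eq_fintype_card]

end Restriction
end CrossedProductModules

/-! ### Clifford theory: restriction from `B` to `C` and orbits of characters -/

section CliffordTheory

variable {K : Type v} [Field K] {C B : Type u} [Ring C] [Algebra K C] [Ring B] [Algebra K B]
  {G : Type*} [Group G] [Fintype G]
  {ι : C →ₐ[K] B} {𝓑 : G → Submodule K B} {P : G → B →ₗ[K] B} {y : G → Bˣ}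
  {V W : Type u} [AddCommGroup V] [Module K V] [Module B V] [IsScalarTower K B V]
  [AddCommGroup W] [Module K W] [Module B W] [IsScalarTower K B W]
  [IsSimpleModule B V] [IsSimpleModule B W]

omit [Module K V] [IsScalarTower K B V] [IsSimpleModule B V] in
theorem mem_constituents_pull {ψ : Module.Dual K C} :
    ψ ∈ constituents K C (Pull ι V) ↔ ψ ∈ Irr K C ∧ ∃ v : V, ι (block ψ) • v ≠ 0 :=
  Iff.rfl

variable [Module.Finite K C]

/-! #### Existence of constituents -/

omit [IsScalarTower K B V] in
theorem constituents_pull_nonempty (hC : IsSplitSemisimple K C) :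
    (constituents K C (Pull ι V)).Nonempty := by
  have := IsSimpleModule.nontrivial B V
  obtain ⟨v, hv⟩ := exists_ne (0 : V)
  by_contra hne
  rw [Set.not_nonempty_iff_eq_empty] at hne
  refine hv (((sum_block_smul hC (toPull ι V v)).trans (Finset.sum_eq_zero fun ψ hψ => ?_) :))
  exact block_smul_eq_zero (by simpa using hψ) (by simp [hne]) _

/-- The element `ι (block ψ)` is nonzero, so it acts nontrivially on some simple `B`-module. -/
theorem exists_mem_constituents_pull (hC : IsSplitSemisimple K C) (hB : IsSplitSemisimple K B)
    (hι : Function.Injective ι) {ψ : Module.Dual K C} (hψ : ψ ∈ Irr K C) :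
    ∃ (V : Type u) (_ : AddCommGroup V) (_ : Module K V) (_ : Module B V)
      (_ : IsScalarTower K B V), IsSimpleModule B V ∧ ψ ∈ constituents K C (Pull ι V) := by
  by_contra! hne
  have := hB.1
  refine block_ne_zero hC hψ (hι ?_)
  rw [map_zero]
  refine eq_zero_of_forall_simple (K := K) fun V _ _ _ _ _ v => ?_
  exact block_smul_eq_zero (M := Pull ι V) hψ
    (hne V inferInstance inferInstance inferInstance inferInstance inferInstance) (toPull ι V v)

/-! #### The constituents of a simple module form an orbit -/

omit [Module K V] [IsScalarTower K B V] in
theorem constituents_pull_eq_orbit (hd : IsCrossedProduct ι 𝓑 P y) (hC : IsSplitSemisimple K C)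
    {ψ : Irr K C} (hψ : ψ.1 ∈ constituents K C (Pull ι V)) :
    letI := hd.irrAction
    constituents K C (Pull ι V) = Subtype.val '' MulAction.orbit G ψ := by
  let _ := hd.irrAction
  ext φ
  refine ⟨fun hφ => ?_, ?_⟩
  · refine ⟨⟨φ, hφ.1⟩, ?_, rfl⟩
    by_contra hn
    -- The vectors killed by all blocks in the orbit of `φ` form a `B`-submodule, since homogeneous
    -- elements permute these blocks. If `ψ` lay outside the orbit, `N` would contain every `block ψ
    -- • v`, hence be all of `V`, and `φ` could not occur.
    let N : Submodule B V :=
      { carrier := {v | ∀ g : G, ι (block (g • (⟨φ, hφ.1⟩ : Irr K C)).1) • v = 0}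
        add_mem' := fun ha hb g => by rw [smul_add, ha g, hb g, add_zero]
        zero_mem' := fun g => smul_zero _
        smul_mem' := fun b v hv g => by
          induction b using hd.induction_on with
          | hmem h b hb =>
            have h1 := hd.ι_block_smul hC h (h⁻¹ • g • (⟨φ, hφ.1⟩ : Irr K C))
            rw [smul_inv_smul] at h1
            rw [← mul_smul, hd.ι_block_mul_of_mem hC (Subtype.prop _) h1 hb, mul_smul,
              ← mul_smul h⁻¹ g, hv, smul_zero]
          | hadd a b ha hb => rw [add_smul, smul_add, ha, hb, add_zero] }
    have hN : N = ⊤ := by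
      refine (eq_bot_or_eq_top N).resolve_left fun hbot => ?_
      obtain ⟨-, v, hv⟩ := mem_constituents_pull.1 hψ
      refine hv ((Submodule.mem_bot B).1 (hbot ▸ fun g => ?_))
      rw [← mul_smul, ← map_mul, block_mul_of_ne hC (Subtype.prop _) ψ.2, map_zero, zero_smul]
      intro h
      apply hn
      rw [MulAction.orbit_eq_iff.symm, MulAction.orbit_eq_iff, MulAction.mem_orbit_symm]
      exact ⟨g, Subtype.ext h⟩
    obtain ⟨-, v, hv⟩ := mem_constituents_pull.1 hφ
    have h1 : v ∈ N := hN ▸ Submodule.mem_top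
    have h2 := h1 1
    rw [one_smul] at h2
    exact hv h2
  · rintro ⟨_, ⟨g, rfl⟩, rfl⟩
    obtain ⟨-, v, hv⟩ := mem_constituents_pull.1 hψ
    refine mem_constituents_pull.2 ⟨Subtype.prop _, (y g : B) • v, fun h => hv ?_⟩
    rw [← mul_smul] at h
    have h1 := hd.ι_block_smul hC g ψ
    rw [show (fun m : G => m • ψ) g = g • ψ from rfl, h1, mul_smul] at h
    simpa using congrArg (fun w => (((y g)⁻¹ : Bˣ) : B) • w) h

/-! #### Simple modules with common constituents -/

/-- A common constituent yields a nonzero `C`-linear map from `V` to `W`. One of its twisted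
components is nonzero, hence an isomorphism from a twist of `V` to `W`. -/
theorem exists_character_eq_of_mem_constituents [IsCyclic G]
    [HasEnoughRootsOfUnity K (Nat.card G)] (hd : IsCrossedProduct ι 𝓑 P y)
    (hC : IsSplitSemisimple K C) {ψ : Module.Dual K C}
    (hV : ψ ∈ constituents K C (Pull ι V)) (hW : ψ ∈ constituents K C (Pull ι W)) :
    ∃ ξ : G →* Kˣ, character K B W = character K B V ∘ₗ (hd.twist ξ).toLinearMap := by
  have := finite_linearCharacters G K
  have := Fintype.ofFinite (G →* Kˣ)
  have := hC.1
  obtain ⟨X, hX, hXψ⟩ := exists_simple_submodule_of_mem_constituents hC hV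
  obtain ⟨X', hX', hXψ'⟩ := exists_simple_submodule_of_mem_constituents hC hW
  obtain ⟨φ⟩ := nonempty_linearEquiv_of_character_eq hC X X' (hXψ.trans hXψ'.symm)
  obtain ⟨Y, hXY⟩ := exists_isCompl X
  let f₀ : Pull ι V →ₗ[C] Pull ι W := X'.subtype ∘ₗ φ.toLinearMap ∘ₗ X.projectionOnto Y hXY
  let f : V →ₗ[K] W :=
    (toPull ι W).symm.toLinearMap ∘ₗ f₀.restrictScalars K ∘ₗ (toPull ι V).toLinearMap
  obtain ⟨F, hF, hfF⟩ := exists_sum_isTwistedHom hd (f := f)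
    fun c v => f₀.map_smul c (toPull ι V v)
  by_contra! hne
  have hf0 : f = 0 := by
    rw [hfF]
    refine Finset.sum_eq_zero fun ξ _ => ?_
    by_contra h0
    exact hne ξ ((hF ξ).character_eq h0)
  have := IsSimpleModule.nontrivial C X
  obtain ⟨x, hx⟩ := exists_ne (0 : X)
  have h1 : f₀ x = 0 := LinearMap.congr_fun hf0 ((toPull ι V).symm x)
  simp only [f₀, LinearMap.comp_apply, Submodule.projectionOnto_apply_left] at h1
  exact hx (by simpa using h1)

omit [Module.Finite K C] in
theorem constituents_pull_subset [Module.Finite K B] (hd : IsCrossedProduct ι 𝓑 P y)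
    (hB : IsSplitSemisimple K B) {ξ : G →* Kˣ}
    (h : character K B W = character K B V ∘ₗ (hd.twist ξ).toLinearMap) :
    constituents K C (Pull ι V) ⊆ constituents K C (Pull ι W) := by
  obtain ⟨f, hf, hf0⟩ := exists_isTwistedHom hB hd h
  intro ψ hψ
  obtain ⟨hψ, v, hv⟩ := mem_constituents_pull.1 hψ
  refine mem_constituents_pull.2 ⟨hψ, f v, fun h0 => hv ?_⟩
  rw [← hf.ι_smul] at h0
  exact (hf.bijective hf0).1 (h0.trans (map_zero f).symm)

/-! #### Orbits -/

omit [Module.Finite K C] in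
theorem dualOrbit_subset_irr (hd : IsCrossedProduct ι 𝓑 P y) {χ : Module.Dual K B}
    (hχ : χ ∈ Irr K B) :
    letI := hd.dualAction
    MulAction.orbit (G →* Kˣ) χ ⊆ Irr K B := by
  rintro _ ⟨ξ, rfl⟩
  exact comp_mem_irr hχ (hd.twist_surjective ξ)

section Main

variable [Module.Finite K B] [IsCyclic G] [HasEnoughRootsOfUnity K (Nat.card G)]
  (hd : IsCrossedProduct ι 𝓑 P y) (hC : IsSplitSemisimple K C) (hB : IsSplitSemisimple K B)

include hd hB in
theorem comp_ι_eq_sum_constituents (hC : IsSplitSemisimple K C) :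
    character K B V ∘ₗ ι.toLinearMap = ∑ᶠ ψ ∈ constituents K C (Pull ι V), ψ := by
  have : Module.Finite K (Pull ι V) := finite_of_isSimpleModule (K := K) (B := B) (V := V)
  rw [← character_pull, character_eq_sum_constituents hC (end_comm hd hB)]

include hB hC in
theorem ncard_constituents_pull :
    letI := hd.dualAction
    (constituents K C (Pull ι V)).ncard =
      Nat.card (MulAction.stabilizer (G →* Kˣ) (character K B V)) := by
  have : Module.Finite K (Pull ι V) := finite_of_isSimpleModule (K := K) (B := B) (V := V)
  rw [← finrank_end_eq_ncard_constituents hC (end_comm hd hB), finrank_end hd hB]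

include hB hC in
theorem ncard_constituents_mul_ncard_orbit :
    letI := hd.dualAction
    (constituents K C (Pull ι V)).ncard *
      (MulAction.orbit (G →* Kˣ) (character K B V)).ncard = Nat.card G := by
  let _ := hd.dualAction
  rw [ncard_constituents_pull hd hC hB, ← card_linearCharacters G K,
    ← Subgroup.card_mul_index (MulAction.stabilizer (G →* Kˣ) (character K B V)),
    MulAction.index_stabilizer]

include hB hC in
-- The sum of `χ ∘ twist ξ` over all `ξ` is `|Stab χ|` times the orbit sum, and by `sum_twist` it is
-- also `|G| χ ∘ P 1`.
theorem finsum_orbit_apply (b : B) :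
    letI := hd.dualAction
    (∑ᶠ χ ∈ MulAction.orbit (G →* Kˣ) (character K B V), χ) b =
      ((MulAction.orbit (G →* Kˣ) (character K B V)).ncard : K) * character K B V (P 1 b) := by
  have := finite_linearCharacters G K
  have := Fintype.ofFinite (G →* Kˣ)
  let _ := hd.dualAction
  have h1 := ncard_constituents_mul_ncard_orbit (V := V) hd hC hB
  rw [ncard_constituents_pull hd hC hB] at h1
  have h2 := congrArg (Nat.cast : ℕ → K) h1
  rw [Nat.cast_mul] at h2
  -- The order of the stabilizer divides `|G|`, which is invertible in `K`.
  have hm : (Nat.card (MulAction.stabilizer (G →* Kˣ) (character K B V)) : K) ≠ 0 := by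
    intro h0
    rw [h0, zero_mul] at h2
    exact natCast_card_ne_zero G K h2.symm
  apply mul_left_cancel₀ hm
  rw [← mul_assoc, h2]
  have h3 := LinearMap.congr_fun
    (sum_smul_eq_card_stabilizer_nsmul (H := G →* Kˣ) id (character K B V)) b
  simp only [id] at h3
  rw [← nsmul_eq_mul]
  refine (h3.symm.trans ?_ : _)
  rw [LinearMap.sum_apply, ← smul_eq_mul, ← map_smul, ← hd.sum_twist, map_sum]
  rfl

include hB hC in
-- Both sides act on a simple `B`-module `W` as `1` if its character lies in the orbit and as `0`
-- otherwise.
theorem finsum_ι_block_eq :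
    letI := hd.dualAction
    ∑ᶠ ψ ∈ constituents K C (Pull ι V), ι (block ψ) =
      ∑ᶠ χ ∈ MulAction.orbit (G →* Kˣ) (character K B V), block χ := by
  let _ := hd.dualAction
  have hsub : constituents K C (Pull ι V) ⊆ Irr K C := fun ψ h => h.1
  have hfin := (irr_finite hC).subset hsub
  have hsub' := dualOrbit_subset_irr (χ := character K B V) hd ⟨V, _, _, _, _, ‹_›, rfl⟩
  have hfin' := (irr_finite hB).subset hsub'
  rw [finsum_mem_eq_finite_toFinset_sum _ hfin, finsum_mem_eq_finite_toFinset_sum _ hfin']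
  refine eq_of_forall_simple hB fun W _ _ _ _ _ w => ?_
  by_cases hW : character K B W ∈ MulAction.orbit (G →* Kˣ) (character K B V)
  · rw [sum_block_smul_of_mem hB (by simpa using hsub') W (by simpa using hW)]
    have hWV : constituents K C (Pull ι W) ⊆ constituents K C (Pull ι V) := by
      obtain ⟨ξ, hξ⟩ := (MulAction.mem_orbit_symm.1 hW)
      exact constituents_pull_subset hd hB hξ.symm
    rw [Finset.sum_smul]
    refine Eq.trans ?_ (sum_block_smul hC (toPull ι W w)).symm
    refine Finset.sum_subset (Set.Finite.toFinset_subset_toFinset.2 hsub) fun ψ hψ hψ' => ?_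
    exact block_smul_eq_zero (M := Pull ι W) (by simpa using hψ)
      (fun h => hψ' (by simpa using hWV h)) _
  · rw [sum_block_smul_of_notMem hB (by simpa using hsub') W (by simpa using hW), Finset.sum_smul]
    refine Finset.sum_eq_zero fun ψ hψ => ?_
    rw [Set.Finite.mem_toFinset] at hψ
    refine block_smul_eq_zero (M := Pull ι W) hψ.1 (fun h => hW ?_) _
    obtain ⟨ξ, hξ⟩ := exists_character_eq_of_mem_constituents hd hC hψ h
    exact ⟨ξ, hξ.symm⟩

/-! #### Schur elements -/

include hB hC in
theorem centralValue_dualElement_eq {T : B →ₗ[K] K} (hT : IsSymmetrizingForm T)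
    (hT' : IsSymmetrizingForm (T ∘ₗ ι.toLinearMap)) (hT0 : ∀ g ≠ 1, ∀ b ∈ 𝓑 g, T b = 0)
    {ψ : Module.Dual K C} (hψ : ψ ∈ constituents K C (Pull ι V)) :
    letI := hd.dualAction
    centralValue (character K B V) (dualElement T (character K B V)) =
      ((MulAction.orbit (G →* Kˣ) (character K B V)).ncard : K) *
        centralValue ψ (dualElement (T ∘ₗ ι.toLinearMap) ψ) := by
  let _ := hd.dualAction
  set χ := character K B V with hχ
  have hχI : χ ∈ Irr K B := ⟨V, _, _, _, _, ‹_›, rfl⟩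
  have hsub : constituents K C (Pull ι V) ⊆ Irr K C := fun ψ h => h.1
  have hfin := (irr_finite hC).subset hsub
  have hsub' := dualOrbit_subset_irr hd hχI
  have hfin' := (irr_finite hB).subset hsub'
  have hT1 : ∀ b, T b = T (P 1 b) := fun b => by
    conv_lhs => rw [← hd.sum_proj b, map_sum]
    exact Finset.sum_eq_single 1 (fun g _ hg => hT0 g hg _ (hd.proj_mem g b)) (by simp)
  -- Pairing with `b` under `T`, both sides become `|Ω| χ(P 1 b)`, since `T` only sees degree `1`.
  have hsum : ∑ χ' ∈ hfin'.toFinset, dualElement T χ' =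
      ((MulAction.orbit (G →* Kˣ) χ).ncard : K) •
        ι (∑ ψ' ∈ hfin.toFinset, dualElement (T ∘ₗ ι.toLinearMap) ψ') := by
    refine hT.ext fun b => ?_
    have h1 := finsum_orbit_apply (V := V) hd hC hB b
    rw [finsum_mem_eq_finite_toFinset_sum _ hfin'] at h1
    obtain ⟨c, hc⟩ := (hd.mem_one _).1 (hd.proj_mem 1 b)
    have h2 := LinearMap.congr_fun (comp_ι_eq_sum_constituents (V := V) hd hB hC) c
    rw [finsum_mem_eq_finite_toFinset_sum _ hfin] at h2
    rw [Finset.sum_mul, map_sum, smul_mul_assoc, map_smul, smul_eq_mul]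
    simp_rw [apply_dualElement_mul hT]
    rw [← LinearMap.sum_apply, h1, ← hc]
    congr 1
    rw [hT1, hd.proj_ι_mul, ← hc, ← map_mul, Finset.sum_mul]
    refine (h2.trans ?_ : _)
    rw [LinearMap.sum_apply, map_sum, map_sum]
    exact Finset.sum_congr rfl fun ψ' _ => (apply_dualElement_mul hT' ψ' c).symm
  -- On a vector of a simple `C`-submodule with character `ψ`, exactly one summand on each side of
  -- `hsum` survives.
  obtain ⟨X, hX, hXψ⟩ := exists_simple_submodule_of_mem_constituents hC hψ
  have := IsSimpleModule.nontrivial C X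
  obtain ⟨x, hx⟩ := exists_ne (0 : X)
  let v : V := (toPull ι V).symm x
  have hv : v ≠ 0 := fun h => hx (Subtype.ext h)
  have h1 : (∑ χ' ∈ hfin'.toFinset, dualElement T χ') • v =
      centralValue χ (dualElement T χ) • v := by
    rw [Finset.sum_smul, Finset.sum_eq_single χ]
    · exact centralValue_smul hB (dualElement_mul_comm hT (irr_mul_comm hχI)) V v
    · intro χ' hχ' hne
      exact dualElement_smul_of_ne hB hT (hsub' (by simpa using hχ')) V hne.symm v
    · exact fun h => absurd (by simp) h
  have h2 : (∑ ψ' ∈ hfin.toFinset, dualElement (T ∘ₗ ι.toLinearMap) ψ') • x =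
      centralValue ψ (dualElement (T ∘ₗ ι.toLinearMap) ψ) • x := by
    rw [Finset.sum_smul, Finset.sum_eq_single ψ]
    · rw [← hXψ]
      exact centralValue_smul hC (dualElement_mul_comm hT' (irr_mul_comm (hXψ ▸ hψ.1))) X x
    · intro ψ' hψ' hne
      exact dualElement_smul_of_ne hC hT' (hsub (by simpa using hψ')) X
        (fun h => hne (h.symm.trans hXψ)) x
    · exact fun h => absurd (by simpa using hψ) h
  have h3 : ι (∑ ψ' ∈ hfin.toFinset, dualElement (T ∘ₗ ι.toLinearMap) ψ') • v =
      centralValue ψ (dualElement (T ∘ₗ ι.toLinearMap) ψ) • v := congrArg Subtype.val h2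
  rw [hsum, smul_assoc, h3, smul_smul] at h1
  exact (smul_left_injective K hv h1).symm

end Main
end CliffordTheory

/-! ### Characters of induced modules -/

section InducedModules

theorem trace_pi_eq_sum {K X G : Type*} [Field K] [Fintype G] [DecidableEq G] [AddCommGroup X]
    [Module K X] [Module.Finite K X] (f : (G → X) →ₗ[K] (G → X)) :
    LinearMap.trace K (G → X) f = ∑ g, LinearMap.trace K X
      (LinearMap.proj g ∘ₗ f ∘ₗ LinearMap.single K (fun _ : G => X) g) := by
  have h1 : f = ∑ g, (f ∘ₗ LinearMap.single K (fun _ : G => X) g) ∘ₗ LinearMap.proj g := by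
    refine LinearMap.ext fun x => ?_
    rw [LinearMap.sum_apply]
    conv_lhs => rw [← Finset.univ_sum_single x, map_sum]
    rfl
  conv_lhs => rw [h1, map_sum]
  exact Finset.sum_congr rfl fun g _ => LinearMap.trace_comp_comm' _ _

variable {K : Type v} [Field K] {C B : Type u} [Ring C] [Algebra K C] [Ring B] [Algebra K B]
  {G : Type*} [Group G] [Fintype G]
  {ι : C →ₐ[K] B} {𝓑 : G → Submodule K B} {P : G → B →ₗ[K] B} {y : G → Bˣ}

theorem IsCrossedProduct.exists_proj (hd : IsCrossedProduct ι 𝓑 P y) :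
    ∃ π : B →ₗ[K] C, ∀ b, ι (π b) = P 1 b := by
  obtain ⟨r, hr⟩ := ι.toLinearMap.exists_leftInverse_of_injective
    (LinearMap.ker_eq_bot.2 hd.injective)
  refine ⟨r ∘ₗ P 1, fun b => ?_⟩
  obtain ⟨c, hc⟩ := (hd.mem_one _).1 (hd.proj_mem 1 b)
  rw [LinearMap.comp_apply, ← hc]
  exact congrArg ι (LinearMap.congr_fun hr c)

variable {π : B →ₗ[K] C} (X : Type u) [AddCommGroup X] [Module K X] [Module C X]
  [IsScalarTower K C X]

variable (π y) in
/-- The coordinates of `b ⊗ x` with respect to the decomposition of `B` into the `y g * C`. -/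
def indCoord : B ⊗[K] X →ₗ[K] (G → X) :=
  LinearMap.pi fun g => TensorProduct.lift
    ((Algebra.lsmul K K X : C →ₐ[K] Module.End K X).toLinearMap ∘ₗ π ∘ₗ LinearMap.mulLeft K (((y g)⁻¹ : Bˣ) : B))

variable {X}

omit [Group G] [Fintype G] in
theorem indCoord_tmul (b : B) (x : X) (g : G) :
    indCoord y π X (b ⊗ₜ x) g = π (((y g)⁻¹ : Bˣ) * b) • x := by
  simp [indCoord]

variable (hd : IsCrossedProduct ι 𝓑 P y) (hπ : ∀ b, ι (π b) = P 1 b)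
include hd hπ

theorem proj_mul_ι_eq (b : B) (c : C) : π (b * ι c) = π b * c :=
  hd.injective (by rw [hπ, map_mul ι, hπ, hd.proj_mul_ι])

theorem sum_mul_ι_proj (b : B) : ∑ g, (y g : B) * ι (π (((y g)⁻¹ : Bˣ) * b)) = b := by
  conv_rhs => rw [← hd.sum_proj b]
  refine Finset.sum_congr rfl fun g _ => ?_
  rw [hπ, ← hd.proj_mul_of_mem_left (hd.unit_mem g)]
  simp

theorem indCoord_eq_zero {z : B ⊗[K] X} (hz : z ∈ indRelations ι X) : indCoord y π X z = 0 := by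
  -- The relations are a `B`-span while `indCoord` is only `K`-linear, so the induction runs over
  -- all multiples of `z`.
  suffices h : ∀ b : B, indCoord y π X (b • z) = 0 by simpa using h 1
  induction hz using Submodule.span_induction with
  | mem z hz =>
    obtain ⟨b, c, x, rfl⟩ := hz
    intro b'
    ext g
    rw [smul_sub, TensorProduct.smul_tmul', TensorProduct.smul_tmul', map_sub, Pi.sub_apply,
      indCoord_tmul, indCoord_tmul, smul_eq_mul, smul_eq_mul, ← mul_assoc, ← mul_assoc,
      proj_mul_ι_eq hd hπ, mul_smul, mul_assoc, sub_self, Pi.zero_apply]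
  | zero => simp
  | add a b _ _ ha hb => intro c; rw [smul_add, map_add, ha, hb, add_zero]
  | smul a z _ hz => intro c; rw [← mul_smul, hz]

theorem proj_conj (g : G) (b : B) :
    π (((y g)⁻¹ : Bˣ) * (b * y g)) = hd.conj g (π b) := by
  refine hd.injective ?_
  have h1 := hd.proj_mul_of_mem_left (hd.inv_mem g) g (b * y g)
  have h2 := hd.proj_mul_of_mem_right (hd.unit_mem g) 1 b
  rw [inv_mul_cancel] at h1
  rw [one_mul] at h2
  rw [hd.ι_conj, hπ, hπ, h1, h2, mul_assoc]

variable (X)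

/-- The coordinates of an element of the induced module. -/
def indProj : Ind ι X →ₗ[K] (G → X) :=
  ((indRelations ι X).restrictScalars K).liftQ (indCoord y π X)
    (fun _ hz => indCoord_eq_zero hd hπ hz) ∘ₗ
      (Submodule.Quotient.restrictScalarsEquiv K (indRelations ι X)).symm.toLinearMap

theorem indProj_mk (z : B ⊗[K] X) :
    indProj X hd hπ (Submodule.Quotient.mk z) = indCoord y π X z := rfl

omit hd hπ in
variable (ι y) in
/-- The element of the induced module with given coordinates. -/
def indSum : (G → X) →ₗ[K] Ind ι X :=
  ∑ g, ((indRelations ι X).mkQ.restrictScalars K) ∘ₗ (TensorProduct.mk K B X (y g)) ∘ₗ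
    LinearMap.proj g

omit [Group G] [IsScalarTower K C X] hd hπ in
theorem indSum_apply (x : G → X) :
    indSum ι y X x = ∑ g, Submodule.Quotient.mk ((y g : B) ⊗ₜ[K] x g) := by
  simp [indSum]

theorem indProj_indSum (x : G → X) : indProj X hd hπ (indSum ι y X x) = x := by
  ext h
  rw [indSum_apply, map_sum, Finset.sum_apply, Finset.sum_eq_single h]
  · rw [indProj_mk, indCoord_tmul, Units.inv_mul]
    have h1 : π 1 = 1 := hd.injective (by
      rw [hπ, map_one ι]; simpa using hd.proj_of_mem (hd.ι_mem 1))
    rw [h1, one_smul]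
  · intro g _ hne
    have h1 : π (((y h)⁻¹ : Bˣ) * y g) = 0 := hd.injective (by
      rw [hπ, map_zero]
      refine hd.proj_of_ne (hd.mul_mem (hd.inv_mem h) (hd.unit_mem g)) fun h' => hne ?_
      exact (inv_mul_eq_one.1 h'.symm).symm)
    rw [indProj_mk, indCoord_tmul, h1, zero_smul]
  · simp

theorem indSum_indProj (z : Ind ι X) : indSum ι y X (indProj X hd hπ z) = z := by
  obtain ⟨z, rfl⟩ := Submodule.Quotient.mk_surjective _ z
  rw [indProj_mk]
  induction z using TensorProduct.induction_on with
  | zero => simp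
  | add a b ha hb => rw [map_add, map_add, ha, hb, Submodule.Quotient.mk_add]
  | tmul b x =>
    rw [indSum_apply]
    conv_rhs => rw [← sum_mul_ι_proj hd hπ b, TensorProduct.sum_tmul]
    rw [← Submodule.mkQ_apply, map_sum]
    refine Finset.sum_congr rfl fun g _ => ?_
    rw [indCoord_tmul, Submodule.mkQ_apply, eq_comm, Submodule.Quotient.eq]
    exact Submodule.subset_span ⟨_, _, _, rfl⟩

/-- The induced module is a direct sum of copies of `X`. -/
def indEquiv : Ind ι X ≃ₗ[K] (G → X) where
  __ := indProj X hd hπ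
  invFun := indSum ι y X
  left_inv := indSum_indProj X hd hπ
  right_inv := indProj_indSum X hd hπ

/-- The induced module is the direct sum of the `y g ⊗ X`, and the diagonal block of `b` at `g` is
the action of the degree-`1` part of `(y g)⁻¹ * b * y g`. -/
theorem character_ind_apply [Module.Finite K X] (b : B) :
    character K B (Ind ι X) b = ∑ g, character K C X (hd.conj g (π b)) := by
  classical
  rw [character_apply, ← LinearMap.trace_conj' _ (indEquiv X hd hπ), trace_pi_eq_sum]
  refine Finset.sum_congr rfl fun g _ => ?_
  rw [character_apply]
  congr 1
  ext x
  have h1 : indSum ι y X (Pi.single g x) = Submodule.Quotient.mk ((y g : B) ⊗ₜ[K] x) := by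
    rw [indSum_apply, Finset.sum_eq_single g]
    · rw [Pi.single_eq_same]
    · intro h _ hne
      rw [Pi.single_eq_of_ne hne, TensorProduct.tmul_zero, Submodule.Quotient.mk_zero]
    · simp
  change indProj X hd hπ (b • indSum ι y X (Pi.single g x)) g = hd.conj g (π b) • x
  rw [h1, ← Submodule.Quotient.mk_smul, indProj_mk, TensorProduct.smul_tmul', indCoord_tmul,
    smul_eq_mul, proj_conj hd hπ]

omit hπ in
theorem character_ind_eq_finsum_orbit [Module.Finite K B] [Module.Finite K C] [IsCyclic G]
    [HasEnoughRootsOfUnity K (Nat.card G)] (hC : IsSplitSemisimple K C)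
    (hB : IsSplitSemisimple K B) {V : Type u} [AddCommGroup V] [Module K V] [Module B V]
    [IsScalarTower K B V] [IsSimpleModule B V] [IsSimpleModule C X]
    (hX : character K C X ∈ constituents K C (Pull ι V)) :
    letI := hd.dualAction
    character K B (Ind ι X) = ∑ᶠ χ ∈ MulAction.orbit (G →* Kˣ) (character K B V), χ := by
  let _ := hd.dualAction
  let _ := hd.irrAction
  obtain ⟨π, hπ⟩ := hd.exists_proj
  have := finite_of_isSimpleModule (K := K) (B := C) (V := X)
  let ψ : Irr K C := ⟨character K C X, hX.1⟩
  have horb := constituents_pull_eq_orbit (V := V) hd hC (ψ := ψ) hX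
  have hinj : Set.InjOn (Subtype.val : Irr K C → _) (MulAction.orbit G ψ) :=
    Subtype.val_injective.injOn
  -- Both numbers times `|Ω̄|` give `|G|`. Hence both characters take the value `|Ω| χ(P 1 b)` at
  -- `b`.
  have hcard : Nat.card (MulAction.stabilizer G ψ) =
      (MulAction.orbit (G →* Kˣ) (character K B V)).ncard := by
    have h1 := ncard_constituents_mul_ncard_orbit (V := V) hd hC hB
    have h2 := Subgroup.card_mul_index (MulAction.stabilizer G ψ)
    rw [MulAction.index_stabilizer, ← Set.ncard_image_of_injective _ Subtype.val_injective,
      ← horb, ← h1, mul_comm] at h2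
    refine Nat.eq_of_mul_eq_mul_left (Nat.pos_of_ne_zero fun h0 => ?_) h2
    rw [h0, zero_mul] at h1
    exact Nat.card_pos.ne h1
  ext b
  rw [character_ind_apply X hd hπ, finsum_orbit_apply hd hC hB, ← hπ, ← hcard]
  have h3 := LinearMap.congr_fun
    (sum_smul_eq_card_stabilizer_nsmul (H := G) (fun φ : Irr K C => φ.1) ψ) (π b)
  rw [LinearMap.sum_apply] at h3
  refine (h3.trans ?_ : _)
  have h4 := LinearMap.congr_fun (comp_ι_eq_sum_constituents (V := V) hd hB hC) (π b)
  rw [horb, finsum_mem_image hinj] at h4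
  rw [LinearMap.smul_apply, nsmul_eq_mul, ← h4]
  rfl

end InducedModules

/-! ### Roots of unity in splitting fields of cyclic groups -/

/-- Let `n = |G|`. By splitness a generator acts on each simple module by an `n`-th root of unity of
`K`, so it is a root of `p`, the product of `X - c` over these roots. Its first `n` powers are
linearly independent in `KG`, so `p` has degree at least `n`. -/
theorem hasEnoughRootsOfUnity_of_isSplitSemisimple {K G : Type*} [Field K] [Group G] [Finite G]
    [IsCyclic G] (h : IsSplitSemisimple K (MonoidAlgebra K G)) :
    HasEnoughRootsOfUnity K (Nat.card G) := by
  classical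
  have := h.1
  have : NeZero (Nat.card G) := ⟨Nat.card_pos.ne'⟩
  let _ : CommGroup G := IsCyclic.commGroup
  obtain ⟨g, hg⟩ := IsCyclic.exists_generator (α := G)
  have hord : orderOf g = Nat.card G := orderOf_eq_card_of_forall_mem_zpowers hg
  let γ : MonoidAlgebra K G := MonoidAlgebra.of K G g
  have hγ : γ ^ Nat.card G = 1 := by
    rw [← map_pow, ← hord, pow_orderOf_eq_one, map_one]
  let Z := Polynomial.nthRootsFinset (Nat.card G) (1 : K)
  let p : Polynomial K := ∏ c ∈ Z, (Polynomial.X - Polynomial.C c)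
  have hp : Polynomial.aeval γ p = 0 := by
    refine eq_zero_of_forall_simple (K := K) fun V _ _ _ _ _ v => ?_
    obtain ⟨c, hc⟩ := exists_smul_eq_of_central h (z := γ) (fun b => mul_comm γ b) V
    have hV := IsSimpleModule.nontrivial (MonoidAlgebra K G) V
    have hcn : c ^ Nat.card G = 1 := by
      obtain ⟨w, hw⟩ := exists_ne (0 : V)
      have hpow : ∀ k : ℕ, γ ^ k • w = c ^ k • w := by
        intro k
        induction k with
        | zero => simp
        | succ k ih => rw [pow_succ, mul_smul, hc, smul_comm, ih, smul_smul, pow_succ']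
      have h1 := hpow (Nat.card G)
      rw [hγ, one_smul] at h1
      exact smul_left_injective K hw (by simpa using h1.symm)
    have hcZ : c ∈ Z := (Polynomial.mem_nthRootsFinset Nat.card_pos 1).2 hcn
    have h2 : Polynomial.aeval γ (Polynomial.X - Polynomial.C c) • v = 0 := by
      rw [map_sub, Polynomial.aeval_X, Polynomial.aeval_C, sub_smul, hc, algebraMap_smul, sub_self]
    rw [show p = _ from (Finset.prod_erase_mul Z _ hcZ).symm, map_mul, mul_smul, h2, smul_zero]
  have hmonic : p.Monic := Polynomial.monic_prod_of_monic _ _ fun c _ => Polynomial.monic_X_sub_C c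
  have hdeg : p.natDegree = Z.card := by
    rw [Polynomial.natDegree_prod_of_monic _ _ fun c _ => Polynomial.monic_X_sub_C c]
    simp
  have hZ : Nat.card G ≤ Z.card := by
    by_contra! hlt
    have h1 : (Polynomial.aeval γ p).coeff (g ^ p.natDegree) = 1 := by
      rw [Polynomial.aeval_eq_sum_range, MonoidAlgebra.coeff_sum, Finset.sum_apply',
        Finset.sum_eq_single p.natDegree]
      · rw [← map_pow, MonoidAlgebra.of_apply, MonoidAlgebra.coeff_smul_apply,
          MonoidAlgebra.coeff_single, Finsupp.single_eq_same, hmonic.coeff_natDegree, smul_eq_mul,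
          one_mul]
      · intro i hi hne
        have hi' : i < p.natDegree := lt_of_le_of_ne (by simpa [Nat.lt_succ_iff] using hi) hne
        rw [← map_pow, MonoidAlgebra.of_apply, MonoidAlgebra.coeff_smul_apply,
          MonoidAlgebra.coeff_single, Finsupp.single_eq_of_ne, smul_zero]
        intro h'
        refine hne (pow_injOn_Iio_orderOf ?_ ?_ h'.symm) <;> rw [Set.mem_Iio, hord] <;> omega
      · simp
    rw [hp] at h1
    exact zero_ne_one h1
  refine HasEnoughRootsOfUnity.of_card_le (hZ.trans_eq ?_)
  rw [Nat.card_congr (rootsOfUnityEquivNthRoots K (Nat.card G)), Nat.card_eq_fintype_card,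
    Fintype.card_of_subtype Z fun x => ?_]
  rw [Polynomial.mem_nthRootsFinset Nat.card_pos, Polynomial.mem_nthRoots Nat.card_pos]

/-! ### Extension of symmetrizing forms -/

section FormExt

variable {R : Type*} [CommRing R] {A : Type*} [Ring A] [Algebra R A]
  {K : Type*} [Field K] [Algebra R K]

theorem formExt_tmul (t : A →ₗ[R] R) (k : K) (a : A) :
    formExt K t (k ⊗ₜ a) = t a • k := by
  simp [formExt]

theorem formExt_comp_incl (t : A →ₗ[R] R) (S : Subalgebra R A) :
    formExt K (t ∘ₗ S.val.toLinearMap) = formExt K t ∘ₗ (incl K S).toLinearMap := by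
  refine TensorProduct.AlgebraTensorModule.ext fun k a => ?_
  simp [formExt_tmul, incl]

theorem IsSymmetrizingForm.formExt [Module.Free R A] [Module.Finite R A] {t : A →ₗ[R] R}
    (ht : IsSymmetrizingForm t) : IsSymmetrizingForm (formExt K t) where
  trace x y := by
    induction x using TensorProduct.induction_on with
    | zero => simp
    | add x x' hx hx' => rw [add_mul, mul_add, map_add, map_add, hx, hx']
    | tmul k a =>
      induction y using TensorProduct.induction_on with
      | zero => simp
      | add x x' hx hx' => rw [add_mul, mul_add, map_add, map_add, hx, hx']
      | tmul l b =>
        rw [Algebra.TensorProduct.tmul_mul_tmul, Algebra.TensorProduct.tmul_mul_tmul,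
          formExt_tmul, formExt_tmul, ht.trace, mul_comm]
  bijective := by
    have hsurj : Function.Surjective (hat (Clifford.formExt K t)) := by
      intro φ
      let b := Module.Free.chooseBasis R A
      choose d hd using fun i => ht.bijective.2 (b.coord i)
      -- The `d i` are dual to the basis `b` under `t`, so they expand any form explicitly;
      -- injectivity then follows by comparing dimensions.
      refine ⟨∑ i, φ (1 ⊗ₜ b i) • ((1 : K) ⊗ₜ[R] d i), (Algebra.TensorProduct.basis K b).ext
        fun j => ?_⟩
      have h1 : ∀ i, t (d i * b j) = b.coord i (b j) := fun i => LinearMap.congr_fun (hd i) (b j)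
      have h2 : ∀ i, hat (Clifford.formExt K t) ((1 : K) ⊗ₜ[R] d i) (1 ⊗ₜ b j) =
          b.coord i (b j) • (1 : K) := fun i => by
        change Clifford.formExt K t ((1 ⊗ₜ d i) * (1 ⊗ₜ b j)) = _
        rw [Algebra.TensorProduct.tmul_mul_tmul, formExt_tmul, h1, mul_one]
      rw [Algebra.TensorProduct.basis_apply, map_sum, LinearMap.sum_apply, Finset.sum_eq_single j]
      · rw [map_smul, LinearMap.smul_apply, h2]
        simp
      · intro i _ hne
        rw [map_smul, LinearMap.smul_apply, h2]
        simp [Finsupp.single_eq_of_ne hne]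
      · simp
    refine ⟨(LinearMap.injective_iff_surjective_of_finrank_eq_finrank ?_).2 hsurj, hsurj⟩
    exact Subspace.dual_finrank_eq.symm

end FormExt

/-! ### Bijections induced by a relation -/

/-- Lying over is not a function on characters. The two directions of `hod` make it well defined and
injective on orbits. -/
theorem exists_equiv_of_rel {α β γ δ : Type*} {I : Set α} {J : Set β} {o : α → γ} {d : β → δ}
    {r : α → β → Prop} (hr : ∀ a b, r a b → a ∈ I ∧ b ∈ J) (hI : ∀ a ∈ I, ∃ b, r a b)
    (hJ : ∀ b ∈ J, ∃ a, r a b)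
    (hod : ∀ a b a' b', r a b → r a' b' → (o a = o a' ↔ d b = d b')) :
    ∃ Φ : (o '' I) ≃ (d '' J), ∀ x y, Φ x = y → ∃ a b, r a b ∧ x.1 = o a ∧ y.1 = d b := by
  have hx : ∀ x : o '' I, ∃ a b, r a b ∧ x.1 = o a := by
    rintro ⟨_, a, ha, rfl⟩
    obtain ⟨b, hb⟩ := hI a ha
    exact ⟨a, b, hb, rfl⟩
  choose a b hab hxa using hx
  refine ⟨Equiv.ofBijective (fun x => ⟨d (b x), b x, (hr _ _ (hab x)).2, rfl⟩) ⟨?_, ?_⟩, ?_⟩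
  · intro x x' h
    refine Subtype.ext ?_
    rw [hxa, hxa]
    exact (hod _ _ _ _ (hab x) (hab x')).2 (congrArg Subtype.val h)
  · rintro ⟨_, b', hb', rfl⟩
    obtain ⟨a', ha'⟩ := hJ b' hb'
    refine ⟨⟨o a', a', (hr _ _ ha').1, rfl⟩, Subtype.ext ?_⟩
    exact (hod _ _ _ _ (hab _) ha').1 (hxa _).symm
  · rintro x _ rfl
    exact ⟨a x, b x, hab x, hxa x, rfl⟩

/-! ### Extension of scalars of twisted symmetric algebras -/

section Twisted

variable {R : Type*} [CommRing R] {A : Type*} [Ring A] [Algebra R A] {G : Type*} [Group G]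

omit [Group G] in
theorem exists_projections {M : Type*} [AddCommGroup M] [Module R M] [Fintype G] [DecidableEq G]
    {𝒜 : G → Submodule R M} (h : DirectSum.IsInternal 𝒜) :
    ∃ p : G → M →ₗ[R] M, (∀ g x, p g x ∈ 𝒜 g) ∧ (∀ g, ∀ x ∈ 𝒜 g, p g x = x) ∧
      (∀ g h, g ≠ h → ∀ x ∈ 𝒜 h, p g x = 0) ∧ ∀ x, ∑ g, p g x = x := by
  classical
  let _ := h.chooseDecomposition
  let p : G → M →ₗ[R] M := fun g => (𝒜 g).subtype ∘ₗ DirectSum.component R G (fun g => 𝒜 g) g ∘ₗ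
    (DirectSum.decomposeLinearEquiv 𝒜).toLinearMap
  have hp : ∀ g x, p g x = DirectSum.decompose 𝒜 x g := fun g x => rfl
  refine ⟨p, fun g x => Subtype.prop _,
    fun g x hx => (hp g x).trans (DirectSum.decompose_of_mem_same 𝒜 hx),
    fun g h hne x hx => (hp g x).trans (DirectSum.decompose_of_mem_ne 𝒜 hx hne.symm),
    fun x => ?_⟩
  conv_rhs => rw [← DirectSum.sum_support_decompose 𝒜 x]
  symm
  refine Finset.sum_subset (Finset.subset_univ _) fun g _ hg => ?_
  simpa [hp] using hg

/-- Comparing degree-`1` parts in `w * w⁻¹ = 1` shows that the component of `w⁻¹` in degree `g⁻¹` is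
already an inverse of `w`. -/
theorem inv_mem_of_mem [Fintype G] [DecidableEq G] {𝒜 : G → Submodule R A}
    (h : DirectSum.IsInternal 𝒜) (hmul : ∀ g h, 𝒜 g * 𝒜 h = 𝒜 (g * h)) (hone : (1 : A) ∈ 𝒜 1)
    {g : G} {w : Aˣ} (hw : (w : A) ∈ 𝒜 g) : ((w⁻¹ : Aˣ) : A) ∈ 𝒜 g⁻¹ := by
  obtain ⟨p, hp, hpg, hpne, hsum⟩ := exists_projections h
  have hwp : ∀ k, (w : A) * p k (w⁻¹ : Aˣ) ∈ 𝒜 (g * k) := fun k =>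
    hmul g k ▸ Submodule.mul_mem_mul hw (hp k _)
  have h1 : (w : A) * p g⁻¹ (w⁻¹ : Aˣ) = 1 := by
    have h2 : ∑ k, (w : A) * p k (w⁻¹ : Aˣ) = 1 := by rw [← Finset.mul_sum, hsum, Units.mul_inv]
    have h3 := congrArg (p 1) h2
    rw [hpg 1 1 hone, map_sum, Finset.sum_eq_single g⁻¹] at h3
    · rwa [hpg 1 _ (by simpa using hwp g⁻¹)] at h3
    · intro k _ hne
      exact hpne 1 _ (fun h' => hne (eq_inv_of_mul_eq_one_right h'.symm)) _ (hwp k)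
    · simp
  rw [← Units.eq_inv_of_mul_eq_one_left h1]
  exact hp _ _

variable {K : Type*} [Field K] [Algebra R K]

theorem incl_tmul (S : Subalgebra R A) (k : K) (s : S) : incl K S (k ⊗ₜ s) = k ⊗ₜ (s : A) := rfl

theorem baseChange_induction {𝒩 : Submodule R A} {p : K ⊗[R] A → Prop}
    (h1 : ∀ k : K, ∀ a ∈ 𝒩, p (k ⊗ₜ a)) (hadd : ∀ x y, p x → p y → p (x + y)) {x : K ⊗[R] A}
    (hx : x ∈ 𝒩.baseChange K) : p x := by
  obtain ⟨z, rfl⟩ := hx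
  induction z using TensorProduct.induction_on with
  | zero => rw [map_zero]; simpa using h1 0 0 (zero_mem _)
  | add a b ha hb => rw [map_add]; exact hadd _ _ ha hb
  | tmul k a => exact h1 k a a.2

theorem IsTwistedSymmetricAlgebra.exists_isCrossedProduct [Fintype G] [DecidableEq G]
    {t : A →ₗ[R] R} {S : Subalgebra R A} {𝒜 : G → Submodule R A}
    (hA : IsTwistedSymmetricAlgebra t S 𝒜) :
    ∃ (P : G → K ⊗[R] A →ₗ[K] K ⊗[R] A) (y : G → (K ⊗[R] A)ˣ),
      IsCrossedProduct (incl K S) (fun g => (𝒜 g).baseChange K) P y ∧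
        ∀ g, ∃ a ∈ 𝒜 g, (y g : K ⊗[R] A) = 1 ⊗ₜ a := by
  obtain ⟨p, hp, hpg, hpne, hsum⟩ := exists_projections hA.directSum
  have hone : (1 : A) ∈ 𝒜 1 := by rw [hA.one]; exact S.one_mem
  choose a ha hau using hA.exists_unit
  let y : G → (K ⊗[R] A)ˣ := fun g =>
    Units.map (Algebra.TensorProduct.includeRight : A →ₐ[R] K ⊗[R] A).toMonoidHom (hau g).unit
  refine ⟨fun g => (p g).baseChange K, y, ?_, fun g => ⟨a g, ha g, rfl⟩⟩
  refine ⟨?_, fun x => ⟨fun hx => ?_, ?_⟩, ?_, fun g x => ?_, ?_, ?_, fun x => ?_, fun g => ?_,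
    fun g => ?_⟩
  · let r : A →ₗ[R] S := (p 1).codRestrict (Subalgebra.toSubmodule S) fun x => hA.one ▸ hp 1 x
    have hr : ∀ s : S, r s = s := fun s => Subtype.ext (hpg 1 s (by rw [hA.one]; exact s.2))
    refine Function.LeftInverse.injective (g := r.baseChange K) fun z => ?_
    induction z using TensorProduct.induction_on with
    | zero => simp
    | add a b ha hb => rw [map_add, map_add, ha, hb]
    | tmul k s => rw [incl_tmul, LinearMap.baseChange_tmul, hr]
  · refine baseChange_induction (p := fun x => ∃ c, incl K S c = x) (fun k a ha => ?_) ?_ hx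
    · rw [hA.one] at ha
      exact ⟨k ⊗ₜ ⟨a, ha⟩, rfl⟩
    · rintro _ _ ⟨c, rfl⟩ ⟨d, rfl⟩
      exact ⟨c + d, map_add _ _ _⟩
  · rintro ⟨c, rfl⟩
    induction c using TensorProduct.induction_on with
    | zero => rw [map_zero]; exact zero_mem _
    | add a b ha hb => rw [map_add]; exact add_mem ha hb
    | tmul k s => exact Submodule.tmul_mem_baseChange_of_mem k (by rw [hA.one]; exact s.2)
  · intro g h x z hx hz
    refine baseChange_induction (p := fun x => x * z ∈ (𝒜 (g * h)).baseChange K) (fun k a ha => ?_)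
      (fun x x' hx hx' => by rw [add_mul]; exact add_mem hx hx') hx
    refine baseChange_induction (p := fun z => (k ⊗ₜ a) * z ∈ (𝒜 (g * h)).baseChange K)
      (fun l b hb => ?_) (fun x x' hx hx' => by rw [mul_add]; exact add_mem hx hx') hz
    rw [Algebra.TensorProduct.tmul_mul_tmul]
    exact Submodule.tmul_mem_baseChange_of_mem _ (hA.mul g h ▸ Submodule.mul_mem_mul ha hb)
  · induction x using TensorProduct.induction_on with
    | zero => rw [map_zero]; exact zero_mem _
    | add a b ha hb => rw [map_add]; exact add_mem ha hb
    | tmul k s => exact Submodule.tmul_mem_baseChange_of_mem k (hp g s)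
  · intro g x hx
    refine baseChange_induction (p := fun x => (p g).baseChange K x = x) (fun k a ha => ?_)
      (fun x x' hx hx' => by rw [map_add, hx, hx']) hx
    rw [LinearMap.baseChange_tmul, hpg g a ha]
  · intro g h x hx hne
    refine baseChange_induction (p := fun x => (p g).baseChange K x = 0) (fun k a ha => ?_)
      (fun x x' hx hx' => by rw [map_add, hx, hx', add_zero]) hx
    rw [LinearMap.baseChange_tmul, hpne g h hne a ha, TensorProduct.tmul_zero]
  · induction x using TensorProduct.induction_on with
    | zero => simp
    | add a b ha hb => simp_rw [map_add]; rw [Finset.sum_add_distrib, ha, hb]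
    | tmul k s => simp_rw [LinearMap.baseChange_tmul]; rw [← TensorProduct.tmul_sum, hsum]
  · exact Submodule.tmul_mem_baseChange_of_mem _ (ha g)
  · exact Submodule.tmul_mem_baseChange_of_mem _
      (inv_mem_of_mem hA.directSum hA.mul hone (w := (hau g).unit) (ha g))

end Twisted

/-! ### Orbits of characters as group orbits -/

section Orbits

variable {R : Type*} [CommRing R] {K : Type*} [Field K] [Algebra R K] {A : Type*} [Ring A]
  [Algebra R A] {G : Type*} [Group G] [Fintype G]
  {S : Subalgebra R A} {𝒜 : G → Submodule R A} {P : G → K ⊗[R] A →ₗ[K] K ⊗[R] A}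
  {y : G → (K ⊗[R] A)ˣ}
  (hd : IsCrossedProduct (incl K S) (fun g => (𝒜 g).baseChange K) P y)
include hd

theorem orbit_eq [Module.Finite K (K ⊗[R] S)] (hy : ∀ g, ∃ a ∈ 𝒜 g, (y g : K ⊗[R] A) = 1 ⊗ₜ a)
    (hC : IsSplitSemisimple K (K ⊗[R] S)) (ψ : Irr K (K ⊗[R] S)) :
    letI := hd.irrAction
    orbit S 𝒜 ψ.1 = Subtype.val '' MulAction.orbit G ψ := by
  let _ := hd.irrAction
  ext φ
  have key : ∀ g, IsTranslate S 𝒜 g (block ψ.1) (block φ) ↔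
      incl K S (block φ) * y g = y g * incl K S (block ψ.1) := by
    refine fun g => ⟨fun h => ?_, fun h a ha => ?_⟩
    · obtain ⟨a, ha, hya⟩ := hy g
      rw [hya]
      exact h a ha
    · exact hd.ι_block_mul_of_mem hC ψ.2 h (Submodule.tmul_mem_baseChange_of_mem _ ha)
  constructor
  · rintro ⟨hφ, g, hg⟩
    exact ⟨⟨φ, hφ⟩, (hd.mem_orbit_irr_iff hC ψ ⟨φ, hφ⟩).2 ⟨g, (key g).1 hg⟩, rfl⟩
  · rintro ⟨φ, hφ, rfl⟩
    obtain ⟨g, hg⟩ := (hd.mem_orbit_irr_iff hC ψ φ).1 hφ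
    exact ⟨φ.2, g, (key g).2 hg⟩

theorem dualOrbit_eq {χ : Module.Dual K (K ⊗[R] A)} (hχ : χ ∈ Irr K (K ⊗[R] A)) :
    letI := hd.dualAction
    dualOrbit 𝒜 χ = MulAction.orbit (G →* Kˣ) χ := by
  let _ := hd.dualAction
  ext φ
  constructor
  · rintro ⟨-, ξ, hξ⟩
    refine ⟨ξ, LinearMap.ext fun b => ?_⟩
    change χ (hd.twist ξ b) = φ b
    induction b using hd.induction_on with
    | hmem g b hb =>
      rw [hd.twist_of_mem ξ hb]
      refine baseChange_induction (p := fun b => χ ((ξ g : K) • b) = φ b) (fun k a ha => ?_)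
        (fun x x' hx hx' => by rw [smul_add, map_add, hx, hx', map_add]) hb
      have h1 : k ⊗ₜ[R] a = k • ((1 : K) ⊗ₜ[R] a) := by
        rw [TensorProduct.smul_tmul', smul_eq_mul, mul_one]
      rw [h1, map_smul, map_smul, map_smul, hξ g a ha, smul_eq_mul, smul_eq_mul, smul_eq_mul]
      ring
    | hadd a b ha hb => rw [map_add, map_add, ha, hb, map_add]
  · rintro ⟨ξ, rfl⟩
    refine ⟨comp_mem_irr hχ (hd.twist_surjective ξ), ξ, fun g a ha => ?_⟩
    change χ (hd.twist ξ _) = _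
    rw [hd.twist_of_mem ξ (Submodule.tmul_mem_baseChange_of_mem _ ha), map_smul, smul_eq_mul,
      mul_comm]

end Orbits

/-! ### Correspondence of orbits -/

section LiesOver

variable {K : Type v} [Field K] {C B : Type u} [Ring C] [Algebra K C] [Ring B] [Algebra K B]
  {G : Type*} [Group G] [Fintype G]
  {ι : C →ₐ[K] B} {𝓑 : G → Submodule K B} {P : G → B →ₗ[K] B} {y : G → Bˣ}

/-- `χ` is the character of a simple module whose restriction along `ι` has the constituent
`ψ`. -/
def LiesOver (ι : C →ₐ[K] B) (ψ : Module.Dual K C) (χ : Module.Dual K B) : Prop :=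
  ∃ (V : Type u) (_ : AddCommGroup V) (_ : Module K V) (_ : Module B V)
    (_ : IsScalarTower K B V), IsSimpleModule B V ∧ character K B V = χ ∧
      ψ ∈ constituents K C (Pull ι V)

theorem LiesOver.mem_irr {ψ : Module.Dual K C} {χ : Module.Dual K B} (h : LiesOver ι ψ χ) :
    ψ ∈ Irr K C ∧ χ ∈ Irr K B := by
  obtain ⟨V, _, _, _, _, _, rfl, hψ⟩ := h
  exact ⟨hψ.1, V, _, _, _, _, ‹_›, rfl⟩

variable [Module.Finite K C] [Module.Finite K B] [IsCyclic G]
  [HasEnoughRootsOfUnity K (Nat.card G)] (hd : IsCrossedProduct ι 𝓑 P y)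
  (hC : IsSplitSemisimple K C) (hB : IsSplitSemisimple K B)
include hC hB

theorem orbit_eq_orbit_iff_of_liesOver {ψ ψ' : Irr K C} {χ χ' : Module.Dual K B}
    (h : LiesOver ι ψ.1 χ) (h' : LiesOver ι ψ'.1 χ') :
    letI := hd.irrAction
    letI := hd.dualAction
    MulAction.orbit G ψ = MulAction.orbit G ψ' ↔
      MulAction.orbit (G →* Kˣ) χ = MulAction.orbit (G →* Kˣ) χ' := by
  let _ := hd.irrAction
  let _ := hd.dualAction
  obtain ⟨V, _, _, _, _, _, rfl, hψ⟩ := h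
  obtain ⟨V', _, _, _, _, _, rfl, hψ'⟩ := h'
  have h1 := constituents_pull_eq_orbit hd hC hψ
  have h2 := constituents_pull_eq_orbit hd hC hψ'
  constructor
  · intro heq
    rw [← heq, ← h1] at h2
    obtain ⟨ξ, hξ⟩ := exists_character_eq_of_mem_constituents hd hC hψ (h2 ▸ hψ)
    exact (MulAction.orbit_eq_iff.2 ⟨ξ, hξ.symm⟩).symm
  · intro heq
    obtain ⟨ξ, hξ⟩ := MulAction.orbit_eq_iff.1 heq.symm
    have h3 := constituents_pull_eq_orbit hd hC (constituents_pull_subset hd hB hξ.symm hψ)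
    rw [h2] at h3
    exact (Set.image_injective.2 Subtype.val_injective h3).symm

end LiesOver

end Clifford

end

open Clifford in
theorem mainTheorem8
    {𝒪 : Type*} [CommRing 𝒪] [IsDomain 𝒪] [IsNoetherianRing 𝒪] [IsIntegrallyClosed 𝒪]
    {F : Type*} [Field F] [Algebra 𝒪 F] [IsFractionRing 𝒪 F]
    {K : Type w₁} [Field K] [Algebra F K] [Algebra 𝒪 K] [IsScalarTower 𝒪 F K]
    [FiniteDimensional F K] [IsGalois F K]
    {A : Type w₂} [Ring A] [Algebra 𝒪 A] [Module.Free 𝒪 A] [Module.Finite 𝒪 A]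
    {G : Type*} [Group G] [Finite G] [IsCyclic G] [DecidableEq G]
    (t : A →ₗ[𝒪] 𝒪) (S : Subalgebra 𝒪 A) (𝒜 : G → Submodule 𝒪 A)
    (hA : IsTwistedSymmetricAlgebra t S 𝒜)
    (hKA : IsSplitSemisimple K (K ⊗[𝒪] A))
    (hKS : IsSplitSemisimple K (K ⊗[𝒪] S))
    (hKG : IsSplitSemisimple K (MonoidAlgebra K G)) :
    ∃ Φ : Orbits K S 𝒜 ≃ DualOrbits K 𝒜,
      ∀ (Ωbar : Orbits K S 𝒜) (Ω : DualOrbits K 𝒜), Φ Ωbar = Ω →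
        (∑ᶠ ψ ∈ Ωbar.1, incl K S (block ψ) = ∑ᶠ χ ∈ Ω.1, block χ) ∧
        Ωbar.1.ncard * Ω.1.ncard = Nat.card G ∧
        (∀ χ ∈ Ω.1, χ ∘ₗ (incl K S).toLinearMap = ∑ᶠ ψ ∈ Ωbar.1, ψ) ∧
        (∀ ψ ∈ Ωbar.1, ∀ (X : Type (max w₁ w₂)) [AddCommGroup X] [Module K X] [Module (K ⊗[𝒪] S) X]
          [IsScalarTower K (K ⊗[𝒪] S) X] [IsSimpleModule (K ⊗[𝒪] S) X],
          character K (K ⊗[𝒪] S) X = ψ →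
            character K (K ⊗[𝒪] A) (Ind (incl K S) X) = ∑ᶠ χ ∈ Ω.1, χ) ∧
        (∀ χ ∈ Ω.1, ∀ ψ ∈ Ωbar.1,
          schurElement t χ = (Ω.1.ncard : K) * schurElement (t ∘ₗ S.val.toLinearMap) ψ) := by
  have := Fintype.ofFinite G
  have := hasEnoughRootsOfUnity_of_isSplitSemisimple hKG
  have := hA.subalgebra.free_base
  have := hA.subalgebra.finite_base
  obtain ⟨P, y, hd, hy⟩ := hA.exists_isCrossedProduct (K := K)
  let _ := hd.irrAction
  let _ := hd.dualAction
  have ho := orbit_eq hd hy hKS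
  have hdo := fun χ hχ => dualOrbit_eq hd (χ := χ) hχ
  obtain ⟨Φ, hΦ⟩ := exists_equiv_of_rel (I := Irr K (K ⊗[𝒪] S)) (J := Irr K (K ⊗[𝒪] A))
    (o := orbit S 𝒜) (d := dualOrbit 𝒜) (r := LiesOver (incl K S))
    (fun ψ χ h => h.mem_irr)
    (fun ψ hψ => by
      obtain ⟨V, _, _, _, _, _, hV⟩ := exists_mem_constituents_pull hKS hKA hd.injective hψ
      exact ⟨character K (K ⊗[𝒪] A) V, V, _, _, _, _, ‹_›, rfl, hV⟩)
    (fun χ hχ => by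
      obtain ⟨V, _, _, _, _, _, rfl⟩ := hχ
      obtain ⟨ψ, hψ⟩ := constituents_pull_nonempty (ι := incl K S) (V := V) hKS
      exact ⟨ψ, V, _, _, _, _, ‹_›, rfl, hψ⟩)
    (fun ψ χ ψ' χ' h h' => by
      rw [hdo χ h.mem_irr.2, hdo χ' h'.mem_irr.2, ho ⟨ψ, h.mem_irr.1⟩, ho ⟨ψ', h'.mem_irr.1⟩,
        (Set.image_injective.2 Subtype.val_injective).eq_iff]
      exact orbit_eq_orbit_iff_of_liesOver hd hKS hKA (ψ := ⟨ψ, h.mem_irr.1⟩)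
        (ψ' := ⟨ψ', h'.mem_irr.1⟩) h h')
  refine ⟨Φ, fun Ωbar Ω hΩ => ?_⟩
  obtain ⟨ψ₀, χ₀, h₀, hbar, hΩ₀⟩ := hΦ Ωbar Ω hΩ
  rw [ho ⟨ψ₀, h₀.mem_irr.1⟩] at hbar
  rw [hdo χ₀ h₀.mem_irr.2] at hΩ₀
  obtain ⟨V₀, _, _, _, _, _, rfl, hψ₀⟩ := h₀
  have hconst := constituents_pull_eq_orbit hd hKS (ψ := ⟨ψ₀, hψ₀.1⟩) hψ₀
  rw [← hconst] at hbar
  -- All members of `Ω` are twists of one another, so they share the constituents `Ω̄`; any of them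
  -- can replace the chosen `V₀`.
  have hmem : ∀ χ ∈ Ω.1, ∃ (V : Type (max w₁ w₂)) (_ : AddCommGroup V) (_ : Module K V)
      (_ : Module (K ⊗[𝒪] A) V) (_ : IsScalarTower K (K ⊗[𝒪] A) V),
      IsSimpleModule (K ⊗[𝒪] A) V ∧ character K (K ⊗[𝒪] A) V = χ ∧
      constituents K (K ⊗[𝒪] S) (Pull (incl K S) V) = Ωbar.1 ∧
      MulAction.orbit (G →* Kˣ) (character K (K ⊗[𝒪] A) V) = Ω.1 := by
    intro χ hχ
    rw [hΩ₀] at hχ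
    obtain ⟨V, _, _, _, _, _, rfl⟩ :=
      dualOrbit_subset_irr hd ⟨V₀, _, _, _, _, ‹_›, rfl⟩ hχ
    obtain ⟨ξ, hξ⟩ := id hχ
    refine ⟨V, _, _, _, _, ‹_›, rfl, ?_, by rw [hΩ₀]; exact MulAction.orbit_eq_iff.2 hχ⟩
    rw [hbar, hconst]
    exact constituents_pull_eq_orbit hd hKS (ψ := ⟨ψ₀, hψ₀.1⟩)
      (constituents_pull_subset hd hKA hξ.symm hψ₀)
  refine ⟨?_, ?_, fun χ hχ => ?_, fun ψ hψ X _ _ _ _ _ hX => ?_, fun χ hχ ψ hψ => ?_⟩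
  · rw [hbar, hΩ₀]
    exact finsum_ι_block_eq hd hKS hKA
  · rw [hbar, hΩ₀]
    exact ncard_constituents_mul_ncard_orbit hd hKS hKA
  · obtain ⟨V, _, _, _, _, _, rfl, hV, -⟩ := hmem χ hχ
    rw [← hV]
    exact comp_ι_eq_sum_constituents hd hKA hKS
  · rw [hΩ₀]
    exact character_ind_eq_finsum_orbit X hd hKS hKA (by rwa [hX, ← hbar])
  · obtain ⟨V, _, _, _, _, _, rfl, hV, hVΩ⟩ := hmem χ hχ
    have hform := formExt_comp_incl (K := K) t S
    have hS := hA.subalgebra.symmetrizing.formExt (K := K)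
    rw [← hVΩ, schurElement, schurElement, hform]
    rw [hform] at hS
    refine centralValue_dualElement_eq hd hKS hKA hA.symmetrizing.formExt hS
      (fun g hg b hb => ?_) (by rwa [hV])
    refine baseChange_induction (p := fun b => formExt K t b = 0) (fun k a ha => ?_)
      (fun x x' hx hx' => by rw [map_add, hx, hx', add_zero]) hb
    rw [formExt_tmul, hA.form_eq_zero g hg a ha, zero_smul]
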